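/- **Setting.** All logarithms are to base $2$, all Hilbert spaces are finite-dimensional, and $D(\rho,\sigma)=\operatorname{Tr}|\rho-\sigma|$. A unit vector $|\psi\rangle\in\mathbb C^p\otimes\mathbb C^q$ is called separable if it is a product vector, and maximally entangled if $|\psi\rangle=r^{-1/2}\sum_{k=1}^r|u_k\rangle|v_k\rangle$ for some $r\ge 1$ and some orthonormal systems $(u_k)$ in $\mathbb C^p$ and $(v_k)$ in $\mathbb C^q$ (so $r$ may be smaller than $p$ and $q$; equivalently, all non-zero Schmidt coefficients are equal). Its entropy of entanglement is $E=S(\operatorname{Tr}_B|\psi\rangle\langle\psi|)$, with $S$ the von Neumann entropy. Put $|\Phi_d\rangle=d^{-1/2}\sum_{i=1}^d|i\rangle|i\rangle$. An LOCC protocol using $c$ bits of classical communication is a two-way protocol in which at most $c$ bits in total are sent, in either direction. In each step one party, determined by the bits sent so far, applies a two-outcome quantum instrument, which may depend on the bits sent so far, to its own system and sends the outcome bit to the other party; local systems may have any finite dimensions. When the communication is over, each party applies a local operation, depending on the bits sent, that yields its output system and a flag, success or failure. The protocol succeeds if both flags say success. It transforms $|\Phi_d\rangle$ into $|\psi\rangle^{\otimes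 n}$ with error $\epsilon$ and success probability $2^{-s}$ ($s$ real) if, on input $|\Phi_d\rangle$, it succeeds with probability at least $2^{-s}$ and its output state $\sigma$ conditioned on success satisfies $D(\sigma,|\psi\rangle\langle\psi|^{\otimes n})\le\epsilon$. **Theorem.** There is a universal constant $\epsilon_0\ge 0.01$ with the following property. For every bipartite pure state $|\psi\rangle\in\mathbb C^p\otimes\mathbb C^q$ that is neither separable nor maximally entangled there exist constants $\alpha>0$ and $n_0$, depending only on $|\psi\rangle$, such that for all $\epsilon\le\epsilon_0$, all $n\ge n_0$, all $d,c\in\mathbb N$ and all $s\in\mathbb R$, every LOCC protocol that transforms $|\Phi_d\rangle$ into $|\psi\rangle^{\otimes n}$ with error $\epsilon$ and success probability $2^{-s}$, using $c$ bits of classical communication, satisfies (a) $\log d\ge nE+\alpha\sqrt n$, and (b) $c+s\ge\alpha\sqrt n$. -/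

import Mathlib

noncomputable section

open scoped Kronecker MatrixOrder

namespace EntanglementDilution

/-! ### States -/

/-- The density matrix `|v⟩⟨v|`. -/
def pureState {X : Type} (v : X → ℂ) : Matrix X X ℂ :=
  Matrix.vecMulVec v (star v)

/-- The partial trace over the second (Bob's) tensor factor. -/
def traceB {X Y : Type} [Fintype Y] (ρ : Matrix (X × Y) (X × Y) ℂ) : Matrix X X ℂ :=
  Matrix.of fun x x' => ∑ y, ρ (x, y) (x', y)

theorem isHermitian_pureState {X : Type} (v : X → ℂ) : (pureState v).IsHermitian := by
  ext i j
  simp [pureState, Matrix.vecMulVec_apply, mul_comm]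

theorem isHermitian_traceB {X Y : Type} [Fintype Y] {ρ : Matrix (X × Y) (X × Y) ℂ}
    (h : ρ.IsHermitian) : (traceB ρ).IsHermitian := by
  ext i j
  simp only [traceB, Matrix.conjTranspose_apply, Matrix.of_apply, star_sum]
  exact Finset.sum_congr rfl fun y _ => h.apply _ _

/-- The von Neumann entropy, in bits, of a Hermitian matrix: `-∑ λ log₂ λ` over its eigenvalues. -/
def entropy {X : Type} [Fintype X] [DecidableEq X] (ρ : Matrix X X ℂ) (h : ρ.IsHermitian) : ℝ :=
  -∑ i, h.eigenvalues i * Real.logb 2 (h.eigenvalues i)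

/-- The entropy of entanglement of `|ψ⟩ ∈ ℂ^p ⊗ ℂ^q`: the entropy of Alice's reduced state. -/
def entanglementEntropy {p q : ℕ} (ψ : EuclideanSpace ℂ (Fin p × Fin q)) : ℝ :=
  entropy (traceB (pureState ψ.ofLp)) (isHermitian_traceB (isHermitian_pureState _))

/-- A pure state is separable if it is a product vector. -/
def IsSeparable {p q : ℕ} (ψ : EuclideanSpace ℂ (Fin p × Fin q)) : Prop :=
  ∃ (u : EuclideanSpace ℂ (Fin p)) (v : EuclideanSpace ℂ (Fin q)), ∀ i j, ψ (i, j) = u i * v j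

/-- `|ψ⟩` is maximally entangled (of some dimension `r`, possibly smaller than `p` and `q`):
`|ψ⟩ = r^{-1/2} ∑ₖ |uₖ⟩|vₖ⟩` with `r` orthonormal vectors on either side. -/
def IsMaximallyEntangled {p q : ℕ} (ψ : EuclideanSpace ℂ (Fin p × Fin q)) : Prop :=
  ∃ (r : ℕ) (u : Fin r → EuclideanSpace ℂ (Fin p)) (v : Fin r → EuclideanSpace ℂ (Fin q)),
    Orthonormal ℂ u ∧ Orthonormal ℂ v ∧
      ∀ i j, ψ (i, j) = ((√(r : ℝ))⁻¹ : ℝ) * ∑ k, u k i * v k j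

/-- `|Φ_d⟩ = d^{-1/2} ∑ᵢ |i⟩|i⟩`. -/
def maxEntangled (d : ℕ) : Fin d × Fin d → ℂ :=
  fun x => if x.1 = x.2 then (((√(d : ℝ))⁻¹ : ℝ) : ℂ) else 0

/-- `|ψ⟩^{⊗n}`, with Alice holding the `n` first factors and Bob the `n` second factors. -/
def tensorPow {p q : ℕ} (ψ : EuclideanSpace ℂ (Fin p × Fin q)) (n : ℕ) :
    (Fin n → Fin p) × (Fin n → Fin q) → ℂ :=
  fun x => ∏ k, ψ (x.1 k, x.2 k)

/-- The trace distance `D(ρ, σ) = Tr |ρ - σ|` (without a factor `1/2`). -/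
def traceDist {X : Type} [Fintype X] [DecidableEq X] (ρ σ : Matrix X X ℂ) : ℝ :=
  (CFC.abs (ρ - σ)).trace.re

/-! ### LOCC protocols -/

/-- A two-outcome quantum instrument on a system with basis `X`: for each outcome `m` a completely
positive map, given by Kraus operators, into a system with basis `Y m`; the sum of the two maps
preserves the trace. -/
structure Instrument (X : Type) [Fintype X] [DecidableEq X]
    (Y : Bool → Type) [∀ m, Fintype (Y m)] where
  /-- number of Kraus operators -/
  num : Bool → ℕ
  /-- the Kraus operators -/
  kraus : (m : Bool) → Fin (num m) → Matrix (Y m) X ℂ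
  complete : ∑ m, ∑ k, (kraus m k).conjTranspose * kraus m k = 1

/-- The unnormalized state after Alice applied the instrument and saw outcome `m`. -/
def Instrument.applyA {X Z : Type} [Fintype X] [DecidableEq X] [Fintype Z] [DecidableEq Z]
    {Y : Bool → Type} [∀ m, Fintype (Y m)] (I : Instrument X Y) (m : Bool)
    (ρ : Matrix (X × Z) (X × Z) ℂ) : Matrix (Y m × Z) (Y m × Z) ℂ :=
  ∑ k, (I.kraus m k ⊗ₖ (1 : Matrix Z Z ℂ)) * ρ * (I.kraus m k ⊗ₖ (1 : Matrix Z Z ℂ)).conjTranspose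

/-- The unnormalized state after Bob applied the instrument and saw outcome `m`. -/
def Instrument.applyB {X Z : Type} [Fintype X] [DecidableEq X] [Fintype Z] [DecidableEq Z]
    {Y : Bool → Type} [∀ m, Fintype (Y m)] (I : Instrument X Y) (m : Bool)
    (ρ : Matrix (Z × X) (Z × X) ℂ) : Matrix (Z × Y m) (Z × Y m) ℂ :=
  ∑ k, ((1 : Matrix Z Z ℂ) ⊗ₖ I.kraus m k) * ρ * ((1 : Matrix Z Z ℂ) ⊗ₖ I.kraus m k).conjTranspose

/-- `Protocol X Y a b c`: two-way LOCC protocols in which Alice and Bob currently hold systems of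
dimensions `a` and `b`, have at most `c` bits of classical communication (in total, in either
direction) left, and finally output systems with bases `X` and `Y`.

In a communication step one party applies an arbitrary instrument to everything it holds and sends
the one-bit outcome to the other party; everything that follows, including who speaks next, may
depend on the bits sent so far. Ancillas, discarded subsystems, local randomness and private
measurement results are covered, since the instruments are arbitrary completely positive maps
between systems of arbitrary finite dimensions. At the end, without further communication, each
party applies a local operation that produces its output and a flag (`true` for success). -/
inductive Protocol (X Y : Type) [Fintype X] [Fintype Y] : ℕ → ℕ → ℕ → Type
  | done {a b c : ℕ} (opA : Instrument (Fin a) fun _ => X) (opB : Instrument (Fin b) fun _ => Y) :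
      Protocol X Y a b c
  | alice {a b c : ℕ} (a' : Bool → ℕ) (I : Instrument (Fin a) fun m => Fin (a' m))
      (next : (m : Bool) → Protocol X Y (a' m) b c) : Protocol X Y a b (c + 1)
  | bob {a b c : ℕ} (b' : Bool → ℕ) (I : Instrument (Fin b) fun m => Fin (b' m))
      (next : (m : Bool) → Protocol X Y a (b' m) c) : Protocol X Y a b (c + 1)

/-- The unnormalized output state on the event of success (both final flags are `true`), summed
over all transcripts. Its trace is the probability of success. -/
def Protocol.run {X Y : Type} [Fintype X] [Fintype Y] [DecidableEq X] [DecidableEq Y] :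
    {a b c : ℕ} → Protocol X Y a b c → Matrix (Fin a × Fin b) (Fin a × Fin b) ℂ →
      Matrix (X × Y) (X × Y) ℂ
  | _, _, _, .done opA opB, ρ => opB.applyB true (opA.applyA true ρ)
  | _, _, _, .alice _ I next, ρ => ∑ m, (next m).run (I.applyA m ρ)
  | _, _, _, .bob _ I next, ρ => ∑ m, (next m).run (I.applyB m ρ)

/-- The probability that the protocol succeeds on input `ρ`. -/
def Protocol.successProb {X Y : Type} [Fintype X] [Fintype Y] [DecidableEq X] [DecidableEq Y]
    {a b c : ℕ} (P : Protocol X Y a b c) (ρ : Matrix (Fin a × Fin b) (Fin a × Fin b) ℂ) : ℝ :=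
  (P.run ρ).trace.re

/-- The (normalized) output state conditioned on success. -/
def Protocol.output {X Y : Type} [Fintype X] [Fintype Y] [DecidableEq X] [DecidableEq Y]
    {a b c : ℕ} (P : Protocol X Y a b c) (ρ : Matrix (Fin a × Fin b) (Fin a × Fin b) ℂ) :
    Matrix (X × Y) (X × Y) ℂ :=
  (P.successProb ρ : ℂ)⁻¹ • P.run ρ

end EntanglementDilution

end

/-!
The squared Schmidt coefficients of `ψ ^ ⊗n` are the `n`-fold products of those of `ψ`. If `ψ` is
not maximally entangled then `-log₂` of a Schmidt weight has positive variance, so by the central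
limit theorem there is `β > 0` such that, for large `n`, weights above `2 ^ (-(n E + β √n))` have
total mass at most `3 / 4`, and so do the weights in any window `[l, h]` with
`h / l < 2 ^ (2 β √n)`.

Conditioned on its transcript, a protocol is a local operation, and each pair of Kraus operators
`A`, `B` turns the amplitude matrix `d ^ (-1/2) • 1` of `Φ_d` into `d ^ (-1/2) • A * Bᵀ`. This
matrix has rank at most `d`, hence overlap with `ψ ^ ⊗n` bounded by the heavy weights up to an
error controlled by `d l`; this gives (a). It is also `d ^ (-1/2)` times a product of two
contractions, which cannot overlap much with Schmidt weights far above or far below `1 / d`; so up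
to an error only a window of weights around `1 / d` contributes, even after all Kraus operators of
both parties are stacked into contractions. Each of the at most `2 ^ c` transcripts contributes
such an error, and the total must be at least of the order of the success probability, which
gives (b).
-/

noncomputable section

open scoped Kronecker MatrixOrder

namespace EntanglementDilution

section Overlap

open Matrix
open scoped ComplexOrder Matrix.Norms.L2Operator

variable {X Y Z : Type*} [Fintype X] [Fintype Y] [Fintype Z]

/-- The squared Frobenius norm of a matrix. -/
def frobSq (M : Matrix X Y ℂ) : ℝ :=
  ∑ x, ∑ y, ‖M x y‖ ^ 2

/-- The Hilbert–Schmidt inner product of two matrices; for the amplitude matrices of two bipartite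
vectors it is the inner product of the vectors. -/
def overlap (W V : Matrix X Y ℂ) : ℂ :=
  (Wᴴ * V).trace

theorem frobSq_nonneg (M : Matrix X Y ℂ) : 0 ≤ frobSq M := by
  unfold frobSq
  positivity

theorem frobSq_conjTranspose (M : Matrix X Y ℂ) : frobSq Mᴴ = frobSq M := by
  unfold frobSq
  rw [Finset.sum_comm]
  simp only [conjTranspose_apply, norm_star]

theorem frobSq_smul (c : ℂ) (M : Matrix X Y ℂ) : frobSq (c • M) = ‖c‖ ^ 2 * frobSq M := by
  simp only [frobSq, Matrix.smul_apply, smul_eq_mul, norm_mul, mul_pow, Finset.mul_sum]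

theorem overlap_eq_sum (W V : Matrix X Y ℂ) : overlap W V = ∑ x, ∑ y, star (W x y) * V x y := by
  rw [Finset.sum_comm]
  simp only [overlap, trace, diag_apply, Matrix.mul_apply, conjTranspose_apply]

theorem overlap_self (W : Matrix X Y ℂ) : overlap W W = (frobSq W : ℂ) := by
  rw [overlap_eq_sum, frobSq]
  push_cast
  exact Finset.sum_congr rfl fun x _ => Finset.sum_congr rfl fun y _ => Complex.conj_mul' _

theorem overlap_add_left (W₁ W₂ V : Matrix X Y ℂ) :
    overlap (W₁ + W₂) V = overlap W₁ V + overlap W₂ V := by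
  simp only [overlap, conjTranspose_add, Matrix.add_mul, trace_add]

theorem overlap_smul_right (c : ℂ) (W V : Matrix X Y ℂ) : overlap W (c • V) = c * overlap W V := by
  rw [overlap, Matrix.mul_smul, trace_smul, smul_eq_mul, overlap]

theorem overlap_mul_left (E : Matrix X Z ℂ) (G : Matrix Z Y ℂ) (V : Matrix X Y ℂ) :
    overlap (E * G) V = overlap G (Eᴴ * V) := by
  rw [overlap, overlap, conjTranspose_mul, Matrix.mul_assoc]

theorem norm_overlap_le_sum_rows (W V : Matrix X Y ℂ) :
    ‖overlap W V‖ ≤ ∑ x, √(∑ y, ‖W x y‖ ^ 2) * √(∑ y, ‖V x y‖ ^ 2) := by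
  rw [overlap_eq_sum]
  refine norm_sum_le_of_le _ fun x _ => (norm_sum_le _ _).trans ?_
  simp only [norm_mul, norm_star]
  exact Real.sum_mul_le_sqrt_mul_sqrt _ _ _

theorem norm_overlap_le (W V : Matrix X Y ℂ) : ‖overlap W V‖ ≤ √(frobSq W) * √(frobSq V) :=
  (norm_overlap_le_sum_rows W V).trans <|
    Real.sum_sqrt_mul_sqrt_le _ (fun _ => by positivity) fun _ => by positivity

theorem sum_norm_sq_mulVec_le [DecidableEq Y] (M : Matrix X Y ℂ) (v : Y → ℂ) :
    ∑ x, ‖(M *ᵥ v) x‖ ^ 2 ≤ ‖M‖ ^ 2 * ∑ y, ‖v y‖ ^ 2 := by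
  have h := pow_le_pow_left₀ (norm_nonneg _) (l2_opNorm_mulVec M (WithLp.toLp 2 v)) 2
  rw [mul_pow, EuclideanSpace.norm_sq_eq, EuclideanSpace.norm_sq_eq] at h
  simpa using h

theorem sum_norm_sq_row_le [DecidableEq Y] (M : Matrix X Y ℂ) (x : X) :
    ∑ y, ‖M x y‖ ^ 2 ≤ ‖M‖ ^ 2 := by
  classical
  have h := sum_norm_sq_mulVec_le Mᴴ (Pi.single x 1)
  rw [l2_opNorm_conjTranspose] at h
  simpa [Pi.single_apply, apply_ite norm, ite_pow] using h

theorem frobSq_mul_le_left [DecidableEq Y] (M : Matrix X Y ℂ) (N : Matrix Y Z ℂ) :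
    frobSq (M * N) ≤ ‖M‖ ^ 2 * frobSq N := by
  unfold frobSq
  rw [Finset.sum_comm, Finset.sum_comm (f := fun y z => ‖N y z‖ ^ 2), Finset.mul_sum]
  exact Finset.sum_le_sum fun z _ => sum_norm_sq_mulVec_le M fun y => N y z

theorem frobSq_mul_le_right [DecidableEq Z] (M : Matrix X Y ℂ) (N : Matrix Y Z ℂ) :
    frobSq (M * N) ≤ frobSq M * ‖N‖ ^ 2 := by
  classical
  have h := frobSq_mul_le_left Nᴴ Mᴴ
  rwa [← conjTranspose_mul, frobSq_conjTranspose, frobSq_conjTranspose,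
    l2_opNorm_conjTranspose, mul_comm] at h

theorem frobSq_le_norm_sq_mul_card [DecidableEq Y] (M : Matrix X Y ℂ) :
    frobSq M ≤ ‖M‖ ^ 2 * Fintype.card Y := by
  classical
  rw [← l2_opNorm_conjTranspose, ← frobSq_conjTranspose]
  refine (Finset.sum_le_sum fun y _ => sum_norm_sq_row_le Mᴴ y).trans_eq ?_
  rw [Finset.sum_const, Finset.card_univ, nsmul_eq_mul, mul_comm]

theorem norm_overlap_mul_le [DecidableEq Y] (W : Matrix X Y ℂ) (A : Matrix X Z ℂ)
    (B : Matrix Z Y ℂ) : ‖overlap W (A * B)‖ ≤ ‖W‖ * √(frobSq A) * √(frobSq B) := by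
  have heq : overlap W (A * B) = overlap (Aᴴ * W) B := by
    rw [overlap, overlap, conjTranspose_mul, conjTranspose_conjTranspose, Matrix.mul_assoc]
  have hA : frobSq (Aᴴ * W) ≤ ‖W‖ ^ 2 * frobSq A := by
    rw [mul_comm, ← frobSq_conjTranspose A]
    exact frobSq_mul_le_right Aᴴ W
  rw [heq]
  refine (norm_overlap_le _ _).trans ?_
  gcongr
  rw [← Real.sqrt_sq (norm_nonneg W), ← Real.sqrt_mul (by positivity)]
  gcongr

theorem norm_le_one_of_conjTranspose_mul_self_le_one [DecidableEq Y] {M : Matrix X Y ℂ}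
    (h : Mᴴ * M ≤ 1) : ‖M‖ ≤ 1 := by
  have h₀ : (0 : Matrix Y Y ℂ) ≤ Mᴴ * M := (posSemidef_conjTranspose_mul_self M).nonneg
  have h₁ := (CStarAlgebra.norm_le_one_iff_of_nonneg (Mᴴ * M) h₀).2 h
  rw [l2_opNorm_conjTranspose_mul_self] at h₁
  rw [← sq] at h₁
  exact (sq_le_one_iff₀ (norm_nonneg M)).1 h₁

theorem norm_transpose_le_one_of_conjTranspose_mul_self_le_one [DecidableEq X] [DecidableEq Y]
    {M : Matrix X Y ℂ} (h : Mᴴ * M ≤ 1) : ‖Mᵀ‖ ≤ 1 := by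
  rw [← l2_opNorm_conjTranspose]
  refine norm_le_one_of_conjTranspose_mul_self_le_one ?_
  rw [Matrix.le_iff] at h ⊢
  have heq : 1 - Mᵀᴴᴴ * Mᵀᴴ = (1 - Mᴴ * M)ᵀ := by
    rw [transpose_sub, transpose_mul, transpose_one, conjTranspose_conjTranspose]
    rfl
  exact heq ▸ h.transpose

end Overlap

section Schmidt

open Matrix
open scoped ComplexOrder Matrix.Norms.L2Operator

variable {X Y ι : Type*} [Fintype X] [Fintype Y] [DecidableEq ι]

/-- `W` is the amplitude matrix of a vector with squared Schmidt coefficients `w`. The rows of `G`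
are the vectors of one party, scaled by the Schmidt coefficients; zero coefficients are allowed. -/
def HasSchmidtWeights [Fintype ι] (W : Matrix X Y ℂ) (w : ι → ℝ) : Prop :=
  ∃ (E : Matrix X ι ℂ) (G : Matrix ι Y ℂ),
    Eᴴ * E = 1 ∧ G * Gᴴ = diagonal (fun i => (w i : ℂ)) ∧ W = E * G

theorem sum_norm_sq_row_of_mul_conjTranspose_eq_diagonal {G : Matrix ι Y ℂ} {w : ι → ℝ}
    (hG : G * Gᴴ = diagonal (fun i => (w i : ℂ))) (i : ι) : ∑ y, ‖G i y‖ ^ 2 = w i := by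
  apply Complex.ofReal_injective
  have h := congrFun₂ hG i i
  rw [diagonal_apply_eq, Matrix.mul_apply] at h
  rw [← h]
  push_cast
  exact Finset.sum_congr rfl fun y _ => (Complex.mul_conj' _).symm

theorem row_eq_zero_of_mul_conjTranspose_eq_diagonal {G : Matrix ι Y ℂ} {w : ι → ℝ}
    (hG : G * Gᴴ = diagonal (fun i => (w i : ℂ))) {i : ι} (hi : w i = 0) (y : Y) : G i y = 0 := by
  have h := sum_norm_sq_row_of_mul_conjTranspose_eq_diagonal hG i
  rw [hi, Finset.sum_eq_zero_iff_of_nonneg fun _ _ => by positivity] at h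
  simpa using h y (Finset.mem_univ y)

theorem frobSq_mul_of_conjTranspose_mul_self [Fintype ι] {E : Matrix X ι ℂ} (hE : Eᴴ * E = 1)
    (G : Matrix ι Y ℂ) : frobSq (E * G) = frobSq G := by
  apply Complex.ofReal_injective
  rw [← overlap_self, ← overlap_self, overlap_mul_left, ← Matrix.mul_assoc, hE, Matrix.one_mul]

namespace HasSchmidtWeights

variable [Fintype ι] {W : Matrix X Y ℂ} {w : ι → ℝ}

theorem nonneg (h : HasSchmidtWeights W w) (i : ι) : 0 ≤ w i := by
  obtain ⟨E, G, -, hG, -⟩ := h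
  rw [← sum_norm_sq_row_of_mul_conjTranspose_eq_diagonal hG i]
  positivity

theorem sum_eq (h : HasSchmidtWeights W w) : ∑ i, w i = frobSq W := by
  obtain ⟨E, G, hE, hG, rfl⟩ := h
  rw [frobSq_mul_of_conjTranspose_mul_self hE]
  exact Finset.sum_congr rfl fun i _ =>
    (sum_norm_sq_row_of_mul_conjTranspose_eq_diagonal hG i).symm

theorem norm_le [DecidableEq Y] (h : HasSchmidtWeights W w) {l : ℝ} (hl : 0 ≤ l)
    (hw : ∀ i, w i ≤ l) : ‖W‖ ≤ √l := by
  have hw₀ := h.nonneg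
  obtain ⟨E, G, hE, hG, rfl⟩ := h
  have hE₁ : ‖E‖ ≤ 1 := norm_le_one_of_conjTranspose_mul_self_le_one hE.le
  have hG₁ : ‖G‖ ≤ √l := by
    apply Real.le_sqrt_of_sq_le
    rw [← l2_opNorm_conjTranspose, sq, ← l2_opNorm_conjTranspose_mul_self,
      conjTranspose_conjTranspose, hG, l2_opNorm_diagonal]
    refine (pi_norm_le_iff_of_nonneg hl).2 fun i => ?_
    rw [Complex.norm_real, Real.norm_of_nonneg (hw₀ i)]
    exact hw i
  calc ‖E * G‖ ≤ ‖E‖ * ‖G‖ := l2_opNorm_mul E G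
    _ ≤ 1 * √l := by gcongr
    _ = √l := one_mul _

theorem norm_overlap_le_sum_sqrt [DecidableEq Y] (h : HasSchmidtWeights W w) (V : Matrix X Y ℂ) :
    ‖overlap W V‖ ≤ (∑ i, √(w i)) * ‖V‖ := by
  classical
  obtain ⟨E, G, hE, hG, rfl⟩ := h
  have hE₁ : ‖Eᴴ‖ ≤ 1 :=
    (l2_opNorm_conjTranspose E).trans_le (norm_le_one_of_conjTranspose_mul_self_le_one hE.le)
  have hEV : ‖Eᴴ * V‖ ≤ ‖V‖ :=
    (l2_opNorm_mul _ _).trans (mul_le_of_le_one_left (norm_nonneg V) hE₁)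
  rw [overlap_mul_left, Finset.sum_mul]
  refine (norm_overlap_le_sum_rows G (Eᴴ * V)).trans (Finset.sum_le_sum fun i _ => ?_)
  rw [sum_norm_sq_row_of_mul_conjTranspose_eq_diagonal hG]
  gcongr
  exact Real.sqrt_le_iff.2 ⟨norm_nonneg V, (sum_norm_sq_row_le _ i).trans (by gcongr)⟩

theorem exists_add (h : HasSchmidtWeights W w) (p : ι → Prop) [DecidablePred p] :
    ∃ W₁ W₂ : Matrix X Y ℂ, W = W₁ + W₂ ∧
      HasSchmidtWeights W₁ (fun i => if p i then w i else 0) ∧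
      HasSchmidtWeights W₂ (fun i => if p i then 0 else w i) := by
  obtain ⟨E, G, hE, hG, rfl⟩ := h
  have hrow : ∀ i j, ∑ y, G i y * star (G j y) = if i = j then (w i : ℂ) else 0 := fun i j => by
    simpa only [Matrix.mul_apply, diagonal_apply, conjTranspose_apply] using congrFun₂ hG i j
  refine ⟨E * of fun i y => if p i then G i y else 0, E * of fun i y => if p i then 0 else G i y,
    ?_, ⟨E, _, hE, ?_, rfl⟩, ⟨E, _, hE, ?_, rfl⟩⟩
  · rw [← Matrix.mul_add]
    congr 1
    ext i y
    by_cases hi : p i <;> simp [hi]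
  all_goals
    ext i j
    rw [diagonal_apply, Matrix.mul_apply]
    by_cases hi : p i <;> by_cases hj : p j <;> by_cases hij : i = j <;> simp_all

end HasSchmidtWeights

end Schmidt

section KroneckerPow

open Matrix

variable {X Y Z : Type*}

/-- The `n`-fold Kronecker power of a matrix, the amplitude matrix of a tensor power. -/
def kroneckerPow (W : Matrix X Y ℂ) (n : ℕ) : Matrix (Fin n → X) (Fin n → Y) ℂ :=
  of fun x y => ∏ k, W (x k) (y k)

theorem kroneckerPow_mul [Fintype Y] (E : Matrix X Y ℂ) (G : Matrix Y Z ℂ) (n : ℕ) :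
    kroneckerPow (E * G) n = kroneckerPow E n * kroneckerPow G n := by
  ext x z
  simp only [kroneckerPow, Matrix.mul_apply, of_apply, ← Finset.prod_mul_distrib]
  exact Fintype.prod_sum fun k y => E (x k) y * G y (z k)

theorem kroneckerPow_diagonal [DecidableEq X] (D : X → ℂ) (n : ℕ) :
    kroneckerPow (diagonal D) n = diagonal fun I => ∏ k, D (I k) := by
  ext I J
  simp only [kroneckerPow, of_apply, diagonal_apply, Finset.prod_ite_zero, funext_iff,
    Finset.mem_univ, forall_const]

theorem conjTranspose_kroneckerPow (W : Matrix X Y ℂ) (n : ℕ) :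
    (kroneckerPow W n)ᴴ = kroneckerPow Wᴴ n := by
  ext x y
  simp only [kroneckerPow, conjTranspose_apply, of_apply, star_prod]

end KroneckerPow

section SchmidtDecomposition

open Matrix
open scoped ComplexOrder

variable {X Y ι κ K L : Type*} [Fintype X] [Fintype Y]

theorem orthonormal_inv_sqrt_mul_row [DecidableEq ι] {G : Matrix ι Y ℂ} {w : ι → ℝ}
    (hG : G * Gᴴ = diagonal (fun i => (w i : ℂ))) :
    Orthonormal ℂ fun i : {i // 0 < w i} =>
      WithLp.toLp 2 fun y => (√(w i) : ℂ)⁻¹ * G i y := by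
  rw [orthonormal_iff_ite]
  intro i j
  have hrow : ∑ y, G j y * star (G i y) = if (j : ι) = i then (w j : ℂ) else 0 := by
    simpa only [Matrix.mul_apply, diagonal_apply, conjTranspose_apply] using congrFun₂ hG j i
  calc _ = (√(w j) : ℂ)⁻¹ * (√(w i) : ℂ)⁻¹ * ∑ y, G j y * star (G i y) := by
        simp only [PiLp.inner_apply, RCLike.inner_apply, Finset.mul_sum, map_mul, map_inv₀,
          Complex.conj_ofReal, Complex.star_def]
        exact Finset.sum_congr rfl fun y _ => by ring
    _ = if i = j then 1 else 0 := by
        rw [hrow]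
        by_cases hij : i = j
        · have hi : (w i : ℂ) ≠ 0 := Complex.ofReal_ne_zero.2 i.2.ne'
          rw [if_pos hij, ← hij, if_pos rfl, ← mul_inv, ← Complex.ofReal_mul,
            Real.mul_self_sqrt i.2.le, inv_mul_cancel₀ hi]
        · rw [if_neg hij, if_neg fun h => hij (Subtype.ext h.symm), mul_zero]

namespace HasSchmidtWeights

variable [Fintype ι] [DecidableEq ι] {W : Matrix X Y ℂ} {w : ι → ℝ}

theorem kronecker [Fintype K] [Fintype L] [Fintype κ] [DecidableEq κ] {W' : Matrix K L ℂ}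
    {w' : κ → ℝ} (h : HasSchmidtWeights W w) (h' : HasSchmidtWeights W' w') :
    HasSchmidtWeights (W ⊗ₖ W') (fun i : ι × κ => w i.1 * w' i.2) := by
  obtain ⟨E, G, hE, hG, rfl⟩ := h
  obtain ⟨E', G', hE', hG', rfl⟩ := h'
  refine ⟨E ⊗ₖ E', G ⊗ₖ G', ?_, ?_, mul_kronecker_mul _ _ _ _⟩
  · rw [conjTranspose_kronecker, ← mul_kronecker_mul, hE, hE', one_kronecker_one]
  · rw [conjTranspose_kronecker, ← mul_kronecker_mul, hG, hG', diagonal_kronecker_diagonal]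
    simp only [Complex.ofReal_mul]

theorem kroneckerPow (h : HasSchmidtWeights W w) (n : ℕ) :
    HasSchmidtWeights (kroneckerPow W n) (fun I : Fin n → ι => ∏ k, w (I k)) := by
  classical
  obtain ⟨E, G, hE, hG, rfl⟩ := h
  refine ⟨_, _, ?_, ?_, kroneckerPow_mul E G n⟩
  · rw [conjTranspose_kroneckerPow, ← kroneckerPow_mul, hE, ← diagonal_one, kroneckerPow_diagonal]
    simp only [Finset.prod_const_one, diagonal_one]
  · rw [conjTranspose_kroneckerPow, ← kroneckerPow_mul, hG, kroneckerPow_diagonal]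
    simp only [Complex.ofReal_prod]

theorem of_isHermitian [DecidableEq X] (W : Matrix X Y ℂ) (h : (W * Wᴴ).IsHermitian) :
    HasSchmidtWeights W h.eigenvalues := by
  set U : Matrix X X ℂ := (h.eigenvectorUnitary : Matrix X X ℂ)
  have hU : Uᴴ * U = 1 := (Unitary.mem_iff.1 h.eigenvectorUnitary.2).1
  have hU' : U * Uᴴ = 1 := (Unitary.mem_iff.1 h.eigenvectorUnitary.2).2
  have hspec : W * Wᴴ = U * diagonal (fun i => (h.eigenvalues i : ℂ)) * Uᴴ := by
    have := h.spectral_theorem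
    rwa [Unitary.conjStarAlgAut_apply] at this
  refine ⟨U, Uᴴ * W, hU, ?_, ?_⟩
  · calc Uᴴ * W * (Uᴴ * W)ᴴ = Uᴴ * (W * Wᴴ) * U := by
          rw [conjTranspose_mul, conjTranspose_conjTranspose]
          simp only [Matrix.mul_assoc]
      _ = Uᴴ * U * diagonal (fun i => (h.eigenvalues i : ℂ)) * (Uᴴ * U) := by
          rw [congrArg (Uᴴ * · * U) hspec]
          simp only [Matrix.mul_assoc]
      _ = diagonal (fun i => (h.eigenvalues i : ℂ)) := by
          rw [hU, Matrix.one_mul, Matrix.mul_one]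
  · rw [← Matrix.mul_assoc, hU', Matrix.one_mul]

theorem exists_orthonormal (h : HasSchmidtWeights W w) :
    ∃ (u : {i // 0 < w i} → EuclideanSpace ℂ X) (v : {i // 0 < w i} → EuclideanSpace ℂ Y),
      Orthonormal ℂ u ∧ Orthonormal ℂ v ∧
        ∀ x y, W x y = ∑ i : {i // 0 < w i}, (√(w i) : ℂ) * (u i x * v i y) := by
  have hw := h.nonneg
  obtain ⟨E, G, hE, hG, rfl⟩ := h
  refine ⟨fun i => WithLp.toLp 2 fun x => E x i,
    fun i => WithLp.toLp 2 fun y => (√(w i) : ℂ)⁻¹ * G i y, ?_, ?_, fun x y => ?_⟩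
  · rw [orthonormal_iff_ite]
    intro i j
    rw [EuclideanSpace.inner_eq_star_dotProduct, dotProduct_comm]
    exact (congrFun₂ hE i j).trans (by simp only [one_apply, Subtype.ext_iff])
  · exact orthonormal_inv_sqrt_mul_row hG
  · have hsupp : ∀ i ∈ Finset.univ, E x i * G i y ≠ 0 → 0 < w i := fun i _ hi =>
      (hw i).lt_of_ne' fun h0 => hi <| by
        rw [row_eq_zero_of_mul_conjTranspose_eq_diagonal hG h0, mul_zero]
    rw [Matrix.mul_apply, ← Finset.sum_filter_of_ne hsupp,
      Finset.sum_subtype (p := fun i => 0 < w i) _ (by simp)]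
    refine Finset.sum_congr rfl fun i _ => ?_
    have hi : (√(w i) : ℂ) ≠ 0 := Complex.ofReal_ne_zero.2 (Real.sqrt_pos.2 i.2).ne'
    rw [mul_left_comm, mul_inv_cancel_left₀ hi]

theorem exists_mul_eq (h : HasSchmidtWeights W w) :
    ∃ (A : Matrix X ι ℂ) (B : Matrix ι Y ℂ), W = A * B ∧
      frobSq A = Fintype.card {i // w i ≠ 0} ∧ frobSq B = frobSq W := by
  obtain ⟨E, G, hE, hG, rfl⟩ := h
  set D : Matrix ι ι ℂ := diagonal fun i => if w i ≠ 0 then 1 else 0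
  refine ⟨E * D, G, ?_, ?_, (frobSq_mul_of_conjTranspose_mul_self hE G).symm⟩
  · rw [Matrix.mul_assoc]
    congr 1
    ext i y
    rw [diagonal_mul]
    by_cases hi : w i = 0
    · simp [hi, row_eq_zero_of_mul_conjTranspose_eq_diagonal hG hi y]
    · simp [hi]
  · rw [frobSq_mul_of_conjTranspose_mul_self hE, Fintype.card_subtype, Finset.card_filter]
    push_cast
    refine Finset.sum_congr rfl fun i _ => ?_
    rw [Finset.sum_eq_single i]
    · by_cases hi : w i = 0 <;> simp [D, hi]
    · simp +contextual [D, eq_comm]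
    · simp

end HasSchmidtWeights

theorem exists_mul_eq_frobSq_eq_rank (V : Matrix X Y ℂ) :
    ∃ (A : Matrix X X ℂ) (B : Matrix X Y ℂ), V = A * B ∧
      frobSq A = V.rank ∧ frobSq B = frobSq V := by
  classical
  have hV := isHermitian_mul_conjTranspose_self V
  rw [← rank_self_mul_conjTranspose, hV.rank_eq_card_non_zero_eigs]
  exact (HasSchmidtWeights.of_isHermitian V hV).exists_mul_eq

end SchmidtDecomposition

section OverlapBounds

open Matrix
open scoped Matrix.Norms.L2Operator

variable {X Y Z ι : Type*} [Fintype X] [Fintype Y] [Fintype Z] [Fintype ι] [DecidableEq ι]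
  {W : Matrix X Y ℂ} {w : ι → ℝ}

namespace HasSchmidtWeights

theorem norm_overlap_le_of_lt [DecidableEq Y] (hW : HasSchmidtWeights W w) {h : ℝ} (hh : 0 < h)
    (hw : ∀ i, w i ≠ 0 → h < w i) (V : Matrix X Y ℂ) :
    ‖overlap W V‖ ≤ (∑ i, w i) / √h * ‖V‖ := by
  refine (hW.norm_overlap_le_sum_sqrt V).trans ?_
  gcongr
  rw [Finset.sum_div]
  refine Finset.sum_le_sum fun i _ => ?_
  rcases eq_or_ne (w i) 0 with hi | hi
  · simp [hi]
  · rw [le_div_iff₀ (Real.sqrt_pos.2 hh), ← Real.sqrt_mul (hW.nonneg i)]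
    exact Real.sqrt_le_iff.2 ⟨hW.nonneg i, by nlinarith [hw i hi, hW.nonneg i]⟩

theorem norm_overlap_mul_le_of_le (hW : HasSchmidtWeights W w) {l : ℝ}
    (hl : 0 ≤ l) (hw : ∀ i, w i ≤ l) (A : Matrix X Z ℂ) (B : Matrix Z Y ℂ) :
    ‖overlap W (A * B)‖ ≤ √l * √(frobSq A) * √(frobSq B) := by
  classical
  exact (EntanglementDilution.norm_overlap_mul_le W A B).trans (by gcongr; exact hW.norm_le hl hw)

theorem norm_overlap_le_sqrt_sum (hW : HasSchmidtWeights W w) (V : Matrix X Y ℂ) :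
    ‖overlap W V‖ ≤ √(∑ i, w i) * √(frobSq V) := by
  rw [hW.sum_eq]
  exact norm_overlap_le W V

theorem norm_overlap_mul_le [DecidableEq Y] (hW : HasSchmidtWeights W w) {l h : ℝ} (hl : 0 ≤ l)
    (hh : 0 < h) (A : Matrix X Z ℂ) (B : Matrix Z Y ℂ) :
    ‖overlap W (A * B)‖ ≤ (∑ i, w i) / √h * ‖A * B‖ + √l * √(frobSq A) * √(frobSq B) +
      √(∑ i with l ≤ w i ∧ w i ≤ h, w i) * √(frobSq (A * B)) := by
  have hw := hW.nonneg
  -- Weights above `h` cost little because there are few of them, weights below `l` because `A * B`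
  -- factors through `Z`.
  obtain ⟨W₁, W', rfl, hW₁, hW'⟩ := hW.exists_add fun i => h < w i
  obtain ⟨W₂, W₃, rfl, hW₂, hW₃⟩ := hW'.exists_add fun i => w i < l
  have h₁ : ‖overlap W₁ (A * B)‖ ≤ (∑ i, w i) / √h * ‖A * B‖ := by
    refine (hW₁.norm_overlap_le_of_lt hh (fun i hi => ?_) _).trans ?_
    · simp_all
    · gcongr with i
      split_ifs
      exacts [le_rfl, hw i]
  have h₂ : ‖overlap W₂ (A * B)‖ ≤ √l * √(frobSq A) * √(frobSq B) := by
    refine hW₂.norm_overlap_mul_le_of_le hl (fun i => ?_) A B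
    split_ifs with hil hih
    exacts [hl, hil.le, hl]
  have h₃ := hW₃.norm_overlap_le_sqrt_sum (A * B)
  have hwindow : ∑ i, (if w i < l then 0 else if h < w i then 0 else w i) =
      ∑ i with l ≤ w i ∧ w i ≤ h, w i := by
    rw [Finset.sum_filter]
    exact Finset.sum_congr rfl fun i _ => by
      simp only [← not_lt, ite_and, ite_not]
  rw [hwindow] at h₃
  rw [overlap_add_left, overlap_add_left, ← add_assoc]
  refine (norm_add₃_le).trans ?_
  gcongr

theorem norm_overlap_mul_le_of_norm_le_one [DecidableEq Y] [DecidableEq Z]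
    (hW : HasSchmidtWeights W w) (hw : ∑ i, w i = 1) {l h : ℝ} (hl : 0 ≤ l) (hh : 0 < h)
    {A : Matrix X Z ℂ} {B : Matrix Z Y ℂ}
    (hA : ‖A‖ ≤ 1) (hB : ‖B‖ ≤ 1) :
    ‖overlap W (A * B)‖ ≤ 1 / √h + √l * Fintype.card Z +
      √(∑ i with l ≤ w i ∧ w i ≤ h, w i) * √(frobSq (A * B)) := by
  classical
  have hA' : √(frobSq A) ≤ √(Fintype.card Z) := Real.sqrt_le_sqrt <|
    (frobSq_le_norm_sq_mul_card A).trans <| mul_le_of_le_one_left (by positivity) <|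
      pow_le_one₀ (norm_nonneg A) hA
  have hB' : √(frobSq B) ≤ √(Fintype.card Z) := by
    rw [← frobSq_conjTranspose]
    rw [← l2_opNorm_conjTranspose] at hB
    exact Real.sqrt_le_sqrt <| (frobSq_le_norm_sq_mul_card Bᴴ).trans <|
      mul_le_of_le_one_left (by positivity) <| pow_le_one₀ (norm_nonneg Bᴴ) hB
  calc _ ≤ (∑ i, w i) / √h * ‖A * B‖ + √l * √(frobSq A) * √(frobSq B) +
        √(∑ i with l ≤ w i ∧ w i ≤ h, w i) * √(frobSq (A * B)) := hW.norm_overlap_mul_le hl hh A B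
    _ ≤ 1 / √h * 1 + √l * √(Fintype.card Z) * √(Fintype.card Z) +
        √(∑ i with l ≤ w i ∧ w i ≤ h, w i) * √(frobSq (A * B)) := by
      rw [hw]
      gcongr
      exact (l2_opNorm_mul A B).trans (mul_le_one₀ hA (norm_nonneg B) hB)
    _ = _ := by rw [mul_one, mul_assoc, Real.mul_self_sqrt (Nat.cast_nonneg _)]

theorem norm_overlap_le_of_rank (hW : HasSchmidtWeights W w) {l : ℝ} (hl : 0 ≤ l)
    (V : Matrix X Y ℂ) :
    ‖overlap W V‖ ≤ (√(∑ i with l < w i, w i) + √(V.rank * l)) * √(frobSq V) := by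
  classical
  obtain ⟨W₁, W₂, rfl, hW₁, hW₂⟩ := hW.exists_add fun i => l < w i
  obtain ⟨A, B, hV, hA, hB⟩ := exists_mul_eq_frobSq_eq_rank V
  have h₁ := hW₁.norm_overlap_le_sqrt_sum V
  rw [← Finset.sum_filter] at h₁
  have h₂ : ‖overlap W₂ V‖ ≤ √l * √(frobSq A) * √(frobSq B) := by
    rw [hV]
    refine hW₂.norm_overlap_mul_le_of_le hl (fun i => ?_) A B
    split_ifs with hi
    exacts [hl, not_lt.1 hi]
  rw [hA, hB, ← Real.sqrt_mul hl, mul_comm l] at h₂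
  rw [overlap_add_left, add_mul]
  exact (norm_add_le _ _).trans (add_le_add h₁ h₂)

end HasSchmidtWeights

end OverlapBounds

section CentralLimit

open MeasureTheory ProbabilityTheory Filter Topology
open scoped NNReal ENNReal

theorem gaussianReal_zero_Ioi_zero {v : ℝ≥0} (hv : v ≠ 0) :
    gaussianReal 0 v (Set.Ioi 0) = 1 / 2 := by
  have := nullSingletonClass_gaussianReal (μ := 0) hv
  have hsymm : gaussianReal 0 v (Set.Iic 0) = gaussianReal 0 v (Set.Ioi 0) := by
    rw [measure_congr Iio_ae_eq_Iic.symm]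
    conv_rhs => rw [← neg_zero, ← gaussianReal_map_neg, Measure.map_apply (by fun_prop)
      measurableSet_Ioi]
    simp
  have hadd : gaussianReal 0 v (Set.Ioi 0) + gaussianReal 0 v (Set.Ioi 0) = 1 := by
    nth_rw 2 [← hsymm]
    rw [← Set.compl_Ioi, measure_add_measure_compl measurableSet_Ioi, measure_univ]
  rw [ENNReal.eq_div_iff (by simp) (by simp), two_mul, hadd]

theorem exists_one_fourth_lt_gaussianReal_Ioi {v : ℝ≥0} (hv : v ≠ 0) :
    ∃ β : ℝ, 0 < β ∧ 1 / 4 < gaussianReal 0 v (Set.Ioi β) := by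
  have hU : ⋃ n : ℕ, Set.Ioi (1 / ((n : ℝ) + 1)) = Set.Ioi 0 := by
    ext x
    simp only [Set.mem_iUnion, Set.mem_Ioi]
    exact ⟨fun ⟨n, hn⟩ => lt_trans (by positivity) hn, exists_nat_one_div_lt⟩
  have hlim := tendsto_measure_iUnion_atTop (μ := gaussianReal 0 v)
    (s := fun n : ℕ => Set.Ioi (1 / ((n : ℝ) + 1)))
    fun m n hmn => Set.Ioi_subset_Ioi (Nat.one_div_le_one_div hmn)
  rw [hU, gaussianReal_zero_Ioi_zero hv] at hlim
  have hlt : (1 / 4 : ℝ≥0∞) < 1 / 2 := by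
    simp only [one_div]
    exact ENNReal.inv_lt_inv.2 (by norm_num)
  obtain ⟨n, hn⟩ := (hlim.eventually_const_lt hlt).exists
  exact ⟨_, by positivity, hn⟩

theorem exists_tail_of_iIndepFun {Ω : Type*} [MeasurableSpace Ω] {P : Measure Ω}
    [IsProbabilityMeasure P] {X : ℕ → Ω → ℝ} (hX : MemLp (X 0) 2 P) (hmean : P[X 0] = 0)
    (hvar : Var[X 0; P] ≠ 0) (hindep : iIndepFun X P)
    (hident : ∀ i, IdentDistrib (X i) (X 0) P P) :
    ∃ β : ℝ, 0 < β ∧ ∀ᶠ n : ℕ in atTop,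
      1 / 4 < P {ω | β * √n ≤ ∑ k ∈ Finset.range n, X k ω} := by
  have hv : Var[X 0; P].toNNReal ≠ 0 :=
    (Real.toNNReal_pos.2 ((variance_nonneg _ _).lt_of_ne' hvar)).ne'
  obtain ⟨β, hβ, hlt⟩ := exists_one_fourth_lt_gaussianReal_Ioi hv
  refine ⟨β, hβ, ?_⟩
  have hclt := tendstoInDistribution_inv_sqrt_mul_sum_sub HasLaw.id hX hindep hident
  have hlim := ProbabilityMeasure.le_liminf_measure_open_of_tendsto hclt.tendsto
    (isOpen_Ioi (a := β))
  simp only [hmean, mul_zero, sub_zero, Measure.map_id, ProbabilityMeasure.coe_mk] at hlim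
  filter_upwards [eventually_lt_of_lt_liminf (hlt.trans_le hlim)] with n hn
  refine hn.trans_le ?_
  have hae := hclt.forall_aemeasurable n
  simp only [hmean, mul_zero, sub_zero] at hae
  rw [Measure.map_apply_of_aemeasurable hae measurableSet_Ioi]
  refine measure_mono fun ω hω => ?_
  have hω : β < (√n)⁻¹ * ∑ k ∈ Finset.range n, X k ω := hω
  have hn0 : 0 < √(n : ℝ) := (Real.sqrt_nonneg _).lt_of_ne' fun h => by
    rw [h, inv_zero, zero_mul] at hω
    exact hω.not_gt hβ
  rw [lt_inv_mul_iff₀ hn0, mul_comm] at hω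
  exact hω.le

theorem exists_tail_pi {E : Type*} [MeasurableSpace E] {ν : Measure E} [IsProbabilityMeasure ν]
    {f : E → ℝ} (hf : Measurable f) (hL : MemLp f 2 ν) (hmean : ν[f] = 0)
    (hvar : Var[f; ν] ≠ 0) :
    ∃ β : ℝ, 0 < β ∧ ∀ᶠ n : ℕ in atTop,
      1 / 4 < Measure.pi (fun _ : Fin n => ν) {I | β * √n ≤ ∑ k, f (I k)} := by
  obtain ⟨Ω, _, P, Y, hYm, hY, hindep, _⟩ := exists_iid ℕ ν
  have hident : ∀ i, IdentDistrib (f ∘ Y i) f P ν := fun i =>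
    ⟨(hf.comp (hYm i)).aemeasurable, hf.aemeasurable, by
      rw [← Measure.map_map hf (hYm i), (hY i).map_eq]⟩
  obtain ⟨β, hβ, htail⟩ := exists_tail_of_iIndepFun (X := fun i => f ∘ Y i)
    ((hident 0).memLp_iff.2 hL) ((hident 0).integral_eq.trans hmean)
    ((hident 0).variance_eq.trans_ne hvar) (hindep.comp (fun _ => f) fun _ => hf)
    fun i => (hident i).trans (hident 0).symm
  refine ⟨β, hβ, htail.mono fun n hn => hn.trans_eq ?_⟩
  have hmap := (iIndepFun_iff_map_fun_eq_pi_map fun k : Fin n => (hYm k).aemeasurable).1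
    (hindep.precomp Fin.val_injective)
  simp only [fun k : Fin n => (hY k).map_eq] at hmap
  have hYn : Measurable fun ω (k : Fin n) => Y k ω := measurable_pi_lambda _ fun k => hYm k
  rw [← hmap, Measure.map_apply hYn
    (measurableSet_le measurable_const (by fun_prop))]
  simp only [Function.comp_apply, Set.preimage_ofPred_eq, ← Fin.sum_univ_eq_sum_range
    fun k => f (Y k _)]

theorem exists_tail_of_sum_eq_one {ι : Type*} [Fintype ι] {μ f : ι → ℝ} (h0 : ∀ i, 0 ≤ μ i)
    (hμ : ∑ i, μ i = 1) (hf : ∑ i, μ i * f i = 0) (hv : 0 < ∑ i, μ i * f i ^ 2) :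
    ∃ β : ℝ, 0 < β ∧ ∀ᶠ n : ℕ in atTop,
      1 / 4 ≤ ∑ I : Fin n → ι with β * √n ≤ ∑ k, f (I k), ∏ k, μ (I k) := by
  classical
  let : MeasurableSpace ι := ⊤
  let p : PMF ι := PMF.ofFintype (fun i => ENNReal.ofReal (μ i)) <| by
    rw [← ENNReal.ofReal_sum_of_nonneg fun i _ => h0 i, hμ, ENNReal.ofReal_one]
  have hp : ∀ i, p i = ENNReal.ofReal (μ i) := fun _ => rfl
  have hint : ∀ g : ι → ℝ, p.toMeasure[g] = ∑ i, μ i * g i := fun g => by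
    simp [PMF.integral_eq_sum, hp, ENNReal.toReal_ofReal (h0 _)]
  have hfm : Measurable f := measurable_from_top
  have hmean : p.toMeasure[f] = 0 := (hint f).trans hf
  have hvar : Var[f; p.toMeasure] ≠ 0 := by
    rw [variance_of_integral_eq_zero hfm.aemeasurable hmean]
    exact ((hint (f · ^ 2)).trans_gt hv).ne'
  obtain ⟨β, hβ, htail⟩ := exists_tail_pi hfm
    (MemLp.of_bound hfm.aestronglyMeasurable _ (.of_forall fun i =>
      Finset.single_le_sum (f := fun i => ‖f i‖) (fun _ _ => norm_nonneg _) (Finset.mem_univ i)))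
    hmean hvar
  refine ⟨β, hβ, htail.mono fun n hn => ?_⟩
  have hset : Measure.pi (fun _ : Fin n => p.toMeasure) {I | β * √n ≤ ∑ k, f (I k)} =
      ENNReal.ofReal (∑ I : Fin n → ι with β * √n ≤ ∑ k, f (I k), ∏ k, μ (I k)) := by
    rw [ENNReal.ofReal_sum_of_nonneg fun I _ => Finset.prod_nonneg fun k _ => h0 _,
      ← Finset.coe_filter_univ, ← sum_measure_singleton]
    refine Finset.sum_congr rfl fun I _ => ?_
    simp only [Measure.pi_singleton, PMF.toMeasure_apply_singleton _ _ (MeasurableSet.singleton _),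
      hp, ENNReal.ofReal_prod_of_nonneg fun k _ => h0 (I k)]
  rw [hset] at hn
  have := (ENNReal.toReal_lt_of_lt_ofReal hn).le
  simpa using this

theorem exists_tails_of_sum_eq_one {ι : Type*} [Fintype ι] {μ f : ι → ℝ} (h0 : ∀ i, 0 ≤ μ i)
    (hμ : ∑ i, μ i = 1) (hf : ∑ i, μ i * f i = 0) (hv : 0 < ∑ i, μ i * f i ^ 2) :
    ∃ β : ℝ, 0 < β ∧ ∀ᶠ n : ℕ in atTop,
      1 / 4 ≤ ∑ I : Fin n → ι with β * √n ≤ ∑ k, f (I k), ∏ k, μ (I k) ∧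
      1 / 4 ≤ ∑ I : Fin n → ι with ∑ k, f (I k) ≤ -(β * √n), ∏ k, μ (I k) := by
  obtain ⟨β, hβ, hU⟩ := exists_tail_of_sum_eq_one h0 hμ hf hv
  obtain ⟨γ, hγ, hL⟩ := exists_tail_of_sum_eq_one (f := -f) h0 hμ (by simpa using hf)
    (by simpa using hv)
  refine ⟨min β γ, lt_min hβ hγ, ?_⟩
  filter_upwards [hU, hL] with n hn hn'
  constructor
  · refine hn.trans (Finset.sum_le_sum_of_subset_of_nonneg ?_ fun I _ _ =>
      Finset.prod_nonneg fun k _ => h0 _)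
    refine Finset.monotone_filter_right _ fun I _ hI => le_trans ?_ hI
    gcongr
    exact min_le_left _ _
  · refine hn'.trans (Finset.sum_le_sum_of_subset_of_nonneg ?_ fun I _ _ =>
      Finset.prod_nonneg fun k _ => h0 _)
    refine Finset.monotone_filter_right _ fun I _ hI => ?_
    simp only [Pi.neg_apply, Finset.sum_neg_distrib] at hI
    refine (le_neg.1 hI).trans (neg_le_neg ?_)
    gcongr
    exact min_le_right _ _

end CentralLimit

section Anticoncentration

open Filter

theorem logb_prod_eq_sum_logb {ι : Type*} {μ : ι → ℝ} {n : ℕ} {I : Fin n → ι}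
    (hI : 0 < ∏ k, μ (I k)) :
    Real.logb 2 (∏ k, μ (I k)) = ∑ k, Real.logb 2 (μ (I k)) :=
  Real.logb_prod _ _ fun k hk => (Finset.prod_ne_zero_iff.1 hI.ne') k hk

variable {ι κ : Type*} [Fintype ι] [Fintype κ]

/-- The Shannon entropy, in bits, of the weights `μ`. -/
def shannonEntropy (μ : ι → ℝ) : ℝ :=
  -∑ i, μ i * Real.logb 2 (μ i)

variable {μ : ι → ℝ}

theorem sum_filter_le_one_sub_of_disjoint (h0 : ∀ i, 0 ≤ μ i) (hμ : ∑ i, μ i = 1)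
    {p q : ι → Prop} [DecidablePred p] [DecidablePred q] (hpq : ∀ i, 0 < μ i → p i → ¬ q i)
    {t : ℝ} (hq : t ≤ ∑ i with q i, μ i) :
    ∑ i with p i, μ i ≤ 1 - t := by
  have hadd : ∑ i with p i, μ i + ∑ i with q i, μ i ≤ ∑ i, μ i := by
    simp only [Finset.sum_filter, ← Finset.sum_add_distrib]
    refine Finset.sum_le_sum fun i _ => ?_
    rcases (h0 i).eq_or_lt with h | h
    · simp [← h]
    · have := hpq i h
      by_cases hp : p i <;> by_cases hq : q i <;> simp_all
  linarith

theorem exists_tails_neg_logb (h0 : ∀ i, 0 ≤ μ i) (hμ : ∑ i, μ i = 1)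
    (hne : ∃ i, 0 < μ i ∧ Real.logb 2 (μ i) ≠ -shannonEntropy μ) :
    ∃ β : ℝ, 0 < β ∧ ∀ᶠ n : ℕ in atTop,
      1 / 4 ≤ ∑ I : Fin n → ι with
        n * shannonEntropy μ + β * √n ≤ -∑ k, Real.logb 2 (μ (I k)), ∏ k, μ (I k) ∧
      1 / 4 ≤ ∑ I : Fin n → ι with
        -∑ k, Real.logb 2 (μ (I k)) ≤ n * shannonEntropy μ - β * √n, ∏ k, μ (I k) := by
  have hmean : ∑ i, μ i * (-Real.logb 2 (μ i) - shannonEntropy μ) = 0 := by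
    simp only [mul_sub, mul_neg, Finset.sum_sub_distrib, Finset.sum_neg_distrib, ← Finset.sum_mul,
      hμ, one_mul]
    exact sub_self _
  have hvar : 0 < ∑ i, μ i * (-Real.logb 2 (μ i) - shannonEntropy μ) ^ 2 := by
    obtain ⟨i, hi, hne⟩ := hne
    refine Finset.sum_pos' (fun j _ => mul_nonneg (h0 j) (sq_nonneg _)) ⟨i, Finset.mem_univ _, ?_⟩
    exact mul_pos hi (sq_pos_of_ne_zero fun h => hne (by linarith))
  obtain ⟨β, hβ, htails⟩ := exists_tails_of_sum_eq_one h0 hμ hmean hvar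
  refine ⟨β, hβ, htails.mono fun n hn => ?_⟩
  have hsum : ∀ I : Fin n → ι, ∑ k, (-Real.logb 2 (μ (I k)) - shannonEntropy μ) =
      -∑ k, Real.logb 2 (μ (I k)) - n * shannonEntropy μ := fun I => by
    simp [Finset.sum_sub_distrib]
  simpa only [hsum, le_sub_iff_add_le', sub_le_iff_le_add, ← sub_eq_neg_add] using hn

theorem exists_anticoncentration (h0 : ∀ i, 0 ≤ μ i) (hμ : ∑ i, μ i = 1)
    (hne : ∃ i, 0 < μ i ∧ Real.logb 2 (μ i) ≠ -shannonEntropy μ) :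
    ∃ β : ℝ, 0 < β ∧ ∀ᶠ n : ℕ in atTop,
      ∑ I : Fin n → ι with (2 : ℝ) ^ (-(n * shannonEntropy μ + β * √n)) < ∏ k, μ (I k),
        ∏ k, μ (I k) ≤ 3 / 4 ∧
      ∀ l h : ℝ, 0 < l → h < l * 2 ^ (2 * (β * √n)) →
        ∑ I : Fin n → ι with l ≤ ∏ k, μ (I k) ∧ ∏ k, μ (I k) ≤ h, ∏ k, μ (I k) ≤ 3 / 4 := by
  obtain ⟨β, hβ, htails⟩ := exists_tails_neg_logb h0 hμ hne
  refine ⟨β, hβ, htails.mono fun n ⟨hU, hL⟩ => ?_⟩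
  have hp0 : ∀ I : Fin n → ι, 0 ≤ ∏ k, μ (I k) := fun I => Finset.prod_nonneg fun k _ => h0 _
  have hp1 : ∑ I : Fin n → ι, ∏ k, μ (I k) = 1 := by rw [← Fintype.sum_pow, hμ, one_pow]
  have hsub : (1 : ℝ) - 1 / 4 = 3 / 4 := by norm_num
  have htwo : (1 : ℝ) < 2 := one_lt_two
  refine ⟨?_, fun l h hl hlh => ?_⟩
  · refine hsub ▸ sum_filter_le_one_sub_of_disjoint hp0 hp1 (fun I hI hlt hle => ?_) hU
    rw [← Real.lt_logb_iff_rpow_lt htwo hI, logb_prod_eq_sum_logb hI] at hlt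
    linarith
  -- A window of ratio below `2 ^ (2 * (β * √n))` cannot meet both tails.
  by_cases hc : -(n * shannonEntropy μ + β * √n) < Real.logb 2 l
  · refine hsub ▸ sum_filter_le_one_sub_of_disjoint hp0 hp1 (fun I hI hwin hle => ?_) hU
    have := Real.logb_le_logb_of_le htwo hl hwin.1
    rw [logb_prod_eq_sum_logb hI] at this
    linarith
  · refine hsub ▸ sum_filter_le_one_sub_of_disjoint hp0 hp1 (fun I hI hwin hle => ?_) hL
    have := Real.logb_lt_logb htwo hI (hwin.2.trans_lt hlh)
    rw [logb_prod_eq_sum_logb hI, Real.logb_mul hl.ne' (by positivity),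
      Real.logb_rpow two_pos htwo.ne'] at this
    linarith

theorem sum_window_mul_le {v : κ → ℝ} (hv : ∀ j, 0 ≤ v j) (hv1 : ∑ j, v j = 1)
    {l h R m : ℝ} (hl : 0 < l) (hlh : h < l * R)
    (hμ : ∀ l h : ℝ, 0 < l → h < l * R → ∑ i with l ≤ μ i ∧ μ i ≤ h, μ i ≤ m) :
    ∑ i : ι × κ with l ≤ μ i.1 * v i.2 ∧ μ i.1 * v i.2 ≤ h, μ i.1 * v i.2 ≤ m := by
  rw [Finset.sum_filter, Fintype.sum_prod_type_right]
  calc ∑ j, ∑ i, (if l ≤ μ i * v j ∧ μ i * v j ≤ h then μ i * v j else 0)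
      ≤ ∑ j, m * v j := by
        refine Finset.sum_le_sum fun j _ => ?_
        rcases (hv j).eq_or_lt with hj | hj
        · simp [← hj]
        · refine le_trans (le_of_eq ?_) (mul_le_mul_of_nonneg_right
            (hμ (l / v j) (h / v j) (by positivity) ?_) hj.le)
          · rw [Finset.sum_mul, Finset.sum_filter]
            simp only [div_le_iff₀ hj, le_div_iff₀ hj]
          · rw [div_mul_eq_mul_div]
            gcongr
    _ = m := by rw [← Finset.mul_sum, hv1, mul_one]

end Anticoncentration

section LocalOperation

open Matrix
open scoped ComplexOrder

theorem sum_conjTranspose_mul_self_comp_le {X Y Z K L : Type*} [Finite X] [Fintype Y]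
    [Fintype Z] [Fintype K] [Fintype L] [DecidableEq Y] {A : K → Matrix Z Y ℂ}
    {B : L → Matrix Y X ℂ} {M : Matrix X X ℂ} (hA : ∑ k, (A k)ᴴ * A k ≤ 1)
    (hB : ∑ l, (B l)ᴴ * B l ≤ M) :
    ∑ i : K × L, (A i.1 * B i.2)ᴴ * (A i.1 * B i.2) ≤ M := by
  rw [Fintype.sum_prod_type_right]
  refine (Finset.sum_le_sum fun l _ => ?_).trans hB
  have h := (Matrix.le_iff.1 hA).conjTranspose_mul_mul_same (B l)
  rw [Matrix.mul_sub, Matrix.sub_mul, Matrix.mul_one, Matrix.mul_sum, Matrix.sum_mul] at h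
  simpa only [Matrix.le_iff, conjTranspose_mul, Matrix.mul_assoc] using h

variable {X Y Z X' Y' Z' : Type*} [Fintype X] [Fintype Y] [Fintype Z] [Fintype X'] [Fintype Y']
  [Fintype Z'] [DecidableEq X'] [DecidableEq X]

/-- A map that Alice and Bob can implement without communication: each of them applies a trace
non-increasing completely positive map, given by Kraus operators `A` and `B`. -/
def IsLocalOperation (Φ : Matrix (X × X') (X × X') ℂ → Matrix (Y × Y') (Y × Y') ℂ) : Prop :=
  ∃ (K L : Type) (_ : Fintype K) (_ : Fintype L) (A : K → Matrix Y X ℂ) (B : L → Matrix Y' X' ℂ),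
    ∑ k, (A k)ᴴ * A k ≤ 1 ∧ ∑ l, (B l)ᴴ * B l ≤ 1 ∧
      ∀ ρ, Φ ρ = ∑ k, ∑ l, (A k ⊗ₖ B l) * ρ * (A k ⊗ₖ B l)ᴴ

theorem IsLocalOperation.comp [DecidableEq Y] [DecidableEq Y']
    {Ψ : Matrix (Y × Y') (Y × Y') ℂ → Matrix (Z × Z') (Z × Z') ℂ}
    {Φ : Matrix (X × X') (X × X') ℂ → Matrix (Y × Y') (Y × Y') ℂ}
    (hΨ : IsLocalOperation Ψ) (hΦ : IsLocalOperation Φ) : IsLocalOperation (Ψ ∘ Φ) := by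
  obtain ⟨K, L, _, _, A, B, hA, hB, hΨ⟩ := hΨ
  obtain ⟨K', L', _, _, A', B', hA', hB', hΦ⟩ := hΦ
  refine ⟨K × K', L × L', inferInstance, inferInstance, fun k => A k.1 * A' k.2,
    fun l => B l.1 * B' l.2, sum_conjTranspose_mul_self_comp_le hA hA',
    sum_conjTranspose_mul_self_comp_le hB hB', fun ρ => ?_⟩
  simp only [Function.comp_apply, hΨ, hΦ, Fintype.sum_prod_type, mul_kronecker_mul,
    conjTranspose_mul, Matrix.mul_sum, Matrix.sum_mul, Matrix.mul_assoc]
  refine Finset.sum_congr rfl fun k _ => ?_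
  rw [Finset.sum_comm]

theorem IsLocalOperation.posSemidef
    {Φ : Matrix (X × X') (X × X') ℂ → Matrix (Y × Y') (Y × Y') ℂ} (hΦ : IsLocalOperation Φ)
    {ρ : Matrix (X × X') (X × X') ℂ} (hρ : ρ.PosSemidef) : (Φ ρ).PosSemidef := by
  obtain ⟨K, L, _, _, A, B, -, -, hΦ⟩ := hΦ
  rw [hΦ]
  exact posSemidef_sum _ fun k _ => posSemidef_sum _ fun l _ => hρ.mul_mul_conjTranspose_same _

end LocalOperation

section Protocol

open Matrix
open scoped ComplexOrder

theorem Instrument.sum_kraus_le_one {X : Type} [Fintype X] [DecidableEq X] {Y : Bool → Type}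
    [∀ m, Fintype (Y m)] (I : Instrument X Y) (m : Bool) :
    ∑ k, (I.kraus m k)ᴴ * I.kraus m k ≤ 1 := by
  rw [← I.complete]
  exact Finset.single_le_sum (f := fun m => ∑ k, (I.kraus m k)ᴴ * I.kraus m k)
    (fun m _ => Finset.sum_nonneg fun k _ => (posSemidef_conjTranspose_mul_self _).nonneg)
    (Finset.mem_univ m)

theorem Instrument.isLocalOperation_applyA {X Z : Type} [Fintype X] [DecidableEq X] [Fintype Z]
    [DecidableEq Z] {Y : Bool → Type} [∀ m, Fintype (Y m)] (I : Instrument X Y) (m : Bool) :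
    IsLocalOperation (I.applyA (Z := Z) m) :=
  ⟨Fin (I.num m), Unit, inferInstance, inferInstance, I.kraus m, fun _ => 1, I.sum_kraus_le_one m,
    by simp, fun ρ => by simp [Instrument.applyA]⟩

theorem Instrument.isLocalOperation_applyB {X Z : Type} [Fintype X] [DecidableEq X] [Fintype Z]
    [DecidableEq Z] {Y : Bool → Type} [∀ m, Fintype (Y m)] (I : Instrument X Y) (m : Bool) :
    IsLocalOperation (I.applyB (Z := Z) m) :=
  ⟨Unit, Fin (I.num m), inferInstance, inferInstance, fun _ => 1, I.kraus m, by simp,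
    I.sum_kraus_le_one m, fun ρ => by simp [Instrument.applyB]⟩

variable {X Y : Type} [Fintype X] [Fintype Y] [DecidableEq X] [DecidableEq Y] {a b c : ℕ}

theorem Protocol.exists_isLocalOperation (P : Protocol X Y a b c) :
    ∃ (T : Type) (_ : Fintype T)
      (Φ : T → Matrix (Fin a × Fin b) (Fin a × Fin b) ℂ → Matrix (X × Y) (X × Y) ℂ),
      Fintype.card T ≤ 2 ^ c ∧ (∀ t, IsLocalOperation (Φ t)) ∧ ∀ ρ, P.run ρ = ∑ t, Φ t ρ := by
  induction P with
  | done opA opB =>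
    exact ⟨Unit, inferInstance, fun _ => opB.applyB true ∘ opA.applyA true,
      by simpa using Nat.one_le_two_pow,
      fun _ => (opB.isLocalOperation_applyB true).comp (opA.isLocalOperation_applyA true),
      fun ρ => by simp [Protocol.run]⟩
  | alice a' I next ih =>
    choose T _ Φ hT hΦ hrun using ih
    refine ⟨Σ m, T m, inferInstance, fun t => Φ t.1 t.2 ∘ I.applyA t.1, ?_,
      fun t => (hΦ t.1 t.2).comp (I.isLocalOperation_applyA t.1), fun ρ => ?_⟩
    · rw [Fintype.card_sigma, pow_succ']
      simpa using Finset.sum_le_card_nsmul .univ _ _ fun m _ => hT m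
    · simp only [Protocol.run, hrun, Fintype.sum_sigma, Function.comp_apply]
  | bob b' I next ih =>
    choose T _ Φ hT hΦ hrun using ih
    refine ⟨Σ m, T m, inferInstance, fun t => Φ t.1 t.2 ∘ I.applyB t.1, ?_,
      fun t => (hΦ t.1 t.2).comp (I.isLocalOperation_applyB t.1), fun ρ => ?_⟩
    · rw [Fintype.card_sigma, pow_succ']
      simpa using Finset.sum_le_card_nsmul .univ _ _ fun m _ => hT m
    · simp only [Protocol.run, hrun, Fintype.sum_sigma, Function.comp_apply]

theorem Protocol.posSemidef_run (P : Protocol X Y a b c)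
    {ρ : Matrix (Fin a × Fin b) (Fin a × Fin b) ℂ} (hρ : ρ.PosSemidef) :
    (P.run ρ).PosSemidef := by
  obtain ⟨T, _, Φ, -, hΦ, hrun⟩ := P.exists_isLocalOperation
  rw [hrun]
  exact posSemidef_sum _ fun t _ => (hΦ t).posSemidef hρ

end Protocol

section Fidelity

open Matrix
open scoped ComplexOrder

variable {X Y : Type} [Fintype X]

/-- The fidelity `⟨u|ρ|u⟩` of the (not necessarily normalized) state `ρ` with the vector `u`. -/
def fidelity (u : X → ℂ) (ρ : Matrix X X ℂ) : ℝ :=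
  (star u ⬝ᵥ ρ *ᵥ u).re

theorem fidelity_sum {ι : Type*} (u : X → ℂ) (s : Finset ι) (ρ : ι → Matrix X X ℂ) :
    fidelity u (∑ i ∈ s, ρ i) = ∑ i ∈ s, fidelity u (ρ i) := by
  simp only [fidelity, sum_mulVec, dotProduct_sum, Complex.re_sum]

theorem fidelity_smul (u : X → ℂ) (r : ℝ) (ρ : Matrix X X ℂ) :
    fidelity u ((r : ℂ) • ρ) = r * fidelity u ρ := by
  rw [fidelity, smul_mulVec, dotProduct_smul, smul_eq_mul, Complex.re_ofReal_mul, fidelity]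

theorem fidelity_nonneg (u : X → ℂ) {ρ : Matrix X X ℂ} (hρ : ρ.PosSemidef) : 0 ≤ fidelity u ρ :=
  hρ.re_dotProduct_nonneg u

theorem fidelity_conjTranspose_mul_self [Fintype Y] (u : X → ℂ) (N : Matrix Y X ℂ) :
    fidelity u (Nᴴ * N) = ∑ y, ‖(N *ᵥ u) y‖ ^ 2 := by
  rw [fidelity, ← mulVec_mulVec, dotProduct_mulVec, ← star_mulVec, dotProduct, Complex.re_sum]
  refine Finset.sum_congr rfl fun y _ => ?_
  rw [Pi.star_apply, Complex.star_def, Complex.conj_mul', ← Complex.ofReal_pow, Complex.ofReal_re]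

theorem fidelity_le_trace {u : X → ℂ} (hu : ∑ x, ‖u x‖ ^ 2 = 1) {ρ : Matrix X X ℂ}
    (hρ : ρ.PosSemidef) : fidelity u ρ ≤ ρ.trace.re := by
  classical
  obtain ⟨N, rfl⟩ : ∃ N : Matrix X X ℂ, ρ = Nᴴ * N :=
    CStarAlgebra.nonneg_iff_eq_star_mul_self.1 hρ.nonneg
  have htrace : (Nᴴ * N).trace.re = frobSq N := by
    rw [← overlap, overlap_self, Complex.ofReal_re]
  rw [fidelity_conjTranspose_mul_self, htrace]
  refine Finset.sum_le_sum fun x _ => ?_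
  calc ‖(N *ᵥ u) x‖ ^ 2 ≤ (∑ y, ‖N x y‖ * ‖u y‖) ^ 2 := by
        gcongr
        exact norm_sum_le_of_le _ fun y _ => norm_mul_le _ _
    _ ≤ (∑ y, ‖N x y‖ ^ 2) * ∑ y, ‖u y‖ ^ 2 := Finset.sum_mul_sq_le_sq_mul_sq _ _ _
    _ = ∑ y, ‖N x y‖ ^ 2 := by rw [hu, mul_one]

theorem fidelity_pureState (u v : X → ℂ) : fidelity u (pureState v) = ‖star u ⬝ᵥ v‖ ^ 2 := by
  have hconj : star v ⬝ᵥ u = star (star u ⬝ᵥ v) := star_dotProduct v u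
  rw [fidelity, pureState, vecMulVec_mulVec, op_smul_eq_smul, dotProduct_smul, hconj, smul_eq_mul,
    Complex.star_def, Complex.conj_mul', ← Complex.ofReal_pow, Complex.ofReal_re]

theorem mul_pureState_mul_conjTranspose (M : Matrix Y X ℂ) (v : X → ℂ) :
    M * pureState v * Mᴴ = pureState (M *ᵥ v) := by
  rw [pureState, pureState, mul_vecMulVec, vecMulVec_mul, star_mulVec]

theorem posSemidef_pureState {X : Type} [Finite X] (v : X → ℂ) : (pureState v).PosSemidef :=
  posSemidef_vecMulVec_self_star v

theorem one_sub_traceDist_le_fidelity [DecidableEq X] {σ : Matrix X X ℂ} (hσ : σ.IsHermitian)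
    {u : X → ℂ} (hu : ∑ x, ‖u x‖ ^ 2 = 1) :
    1 - traceDist σ (pureState u) ≤ fidelity u σ := by
  have hΔ : IsSelfAdjoint (σ - pureState u) := hσ.sub (isHermitian_pureState u)
  have habs : 0 ≤ CFC.abs (σ - pureState u) + (σ - pureState u) := by
    rw [CFC.abs_add_self _ hΔ]
    exact smul_nonneg zero_le_two (CFC.posPart_nonneg _)
  have hadd : 0 ≤ fidelity u (CFC.abs (σ - pureState u) + (σ - pureState u)) :=
    fidelity_nonneg u (nonneg_iff_posSemidef.1 habs)
  have hle : fidelity u (CFC.abs (σ - pureState u)) ≤ traceDist σ (pureState u) :=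
    fidelity_le_trace hu (nonneg_iff_posSemidef.1 (CFC.abs_nonneg _))
  have hone : fidelity u (pureState u) = 1 := by
    have hdot : star u ⬝ᵥ u = 1 := by
      rw [← Complex.ofReal_one, ← hu, dotProduct]
      push_cast
      exact Finset.sum_congr rfl fun x _ => Complex.conj_mul' _
    rw [fidelity_pureState, hdot, norm_one, one_pow]
  have hsplit : fidelity u (CFC.abs (σ - pureState u) + (σ - pureState u)) =
      fidelity u (CFC.abs (σ - pureState u)) + (fidelity u σ - fidelity u (pureState u)) := by
    simp only [fidelity, add_mulVec, sub_mulVec, dotProduct_add, dotProduct_sub, Complex.add_re,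
      Complex.sub_re]
  linarith

theorem Protocol.mul_successProb_le_fidelity_run [Fintype Y] [DecidableEq X] [DecidableEq Y]
    {a b c : ℕ} (P : Protocol X Y a b c) {ρ : Matrix (Fin a × Fin b) (Fin a × Fin b) ℂ}
    (hρ : ρ.PosSemidef) {u : X × Y → ℂ} (hu : ∑ x, ‖u x‖ ^ 2 = 1) (hpos : 0 < P.successProb ρ)
    {ε : ℝ} (hε : traceDist (P.output ρ) (pureState u) ≤ ε) :
    (1 - ε) * P.successProb ρ ≤ fidelity u (P.run ρ) := by
  have hout : P.output ρ = ((P.successProb ρ)⁻¹ : ℝ) • P.run ρ := by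
    rw [Protocol.output, ← Complex.ofReal_inv, Complex.coe_smul]
  have hherm : (P.output ρ).IsHermitian := by
    rw [hout]
    exact (P.posSemidef_run hρ).isHermitian.smul (IsSelfAdjoint.all _)
  have hfid := one_sub_traceDist_le_fidelity hherm hu
  rw [hout, ← Complex.coe_smul, fidelity_smul, inv_mul_eq_div, Complex.coe_smul, ← hout,
    le_div_iff₀ hpos] at hfid
  exact (by gcongr : _ ≤ _).trans hfid

end Fidelity

section Amplitude

open Matrix

/-- The coefficient matrix of a vector on a bipartite system: `|v⟩ = ∑ₓ,ᵧ Vₓᵧ |x⟩|y⟩`. -/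
def amplitudeMatrix {X Y : Type*} (v : X × Y → ℂ) : Matrix X Y ℂ :=
  of fun x y => v (x, y)

theorem amplitudeMatrix_tensorPow {p q : ℕ} (ψ : EuclideanSpace ℂ (Fin p × Fin q)) (n : ℕ) :
    amplitudeMatrix (tensorPow ψ n) = kroneckerPow (amplitudeMatrix ψ.ofLp) n :=
  rfl

theorem amplitudeMatrix_maxEntangled (d : ℕ) :
    amplitudeMatrix (maxEntangled d) =
      (((√(d : ℝ))⁻¹ : ℝ) : ℂ) • (1 : Matrix (Fin d) (Fin d) ℂ) := by
  ext i j
  simp only [amplitudeMatrix, maxEntangled, of_apply, Matrix.smul_apply, one_apply, smul_eq_mul,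
    mul_ite, mul_one, mul_zero]

variable {X Y X' Y' : Type*} [Fintype X] [Fintype Y]

theorem frobSq_amplitudeMatrix (v : X × Y → ℂ) :
    frobSq (amplitudeMatrix v) = ∑ x, ‖v x‖ ^ 2 :=
  (Fintype.sum_prod_type fun x => ‖v x‖ ^ 2).symm

theorem overlap_amplitudeMatrix (u v : X × Y → ℂ) :
    overlap (amplitudeMatrix u) (amplitudeMatrix v) = star u ⬝ᵥ v := by
  rw [overlap_eq_sum, dotProduct, Fintype.sum_prod_type]
  rfl

theorem amplitudeMatrix_kronecker_mulVec (A : Matrix X' X ℂ) (B : Matrix Y' Y ℂ)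
    (v : X × Y → ℂ) :
    amplitudeMatrix ((A ⊗ₖ B) *ᵥ v) = A * amplitudeMatrix v * Bᵀ := by
  ext x' y'
  simp only [amplitudeMatrix, of_apply, mulVec, dotProduct, Fintype.sum_prod_type_right,
    kronecker_apply, Matrix.mul_apply, transpose_apply, Finset.sum_mul]
  exact Finset.sum_congr rfl fun y _ => Finset.sum_congr rfl fun x _ => by ring

end Amplitude

section AmplitudeOfLocalOperation

open Matrix

variable {X Y X' Y' : Type} [Fintype X] [Fintype Y] [Fintype X'] [Fintype Y']

theorem fidelity_kronecker_mul_pureState (A : Matrix X' X ℂ) (B : Matrix Y' Y ℂ)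
    (u : X' × Y' → ℂ) (v : X × Y → ℂ) :
    fidelity u ((A ⊗ₖ B) * pureState v * (A ⊗ₖ B)ᴴ) =
      ‖overlap (amplitudeMatrix u) (A * amplitudeMatrix v * Bᵀ)‖ ^ 2 := by
  rw [mul_pureState_mul_conjTranspose, fidelity_pureState, ← overlap_amplitudeMatrix,
    amplitudeMatrix_kronecker_mulVec]

theorem trace_re_kronecker_mul_pureState (A : Matrix X' X ℂ) (B : Matrix Y' Y ℂ)
    (v : X × Y → ℂ) :
    ((A ⊗ₖ B) * pureState v * (A ⊗ₖ B)ᴴ).trace.re = frobSq (A * amplitudeMatrix v * Bᵀ) := by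
  rw [mul_pureState_mul_conjTranspose, pureState, trace_vecMulVec, dotProduct_comm,
    ← overlap_amplitudeMatrix, overlap_self, Complex.ofReal_re, amplitudeMatrix_kronecker_mulVec]

end AmplitudeOfLocalOperation

section Stack

open Matrix
open scoped Matrix.Norms.L2Operator

variable {X Y Z K L : Type*}

/-- The matrices `A k` stacked on top of each other: the contraction that performs the operation
with Kraus operators `A` and records the outcome in a register with basis `K`. -/
def stack (A : K → Matrix X Z ℂ) : Matrix (X × K) Z ℂ :=
  of fun x z => A x.2 x.1 z

theorem conjTranspose_stack_mul_stack [Fintype X] [Fintype K] (A : K → Matrix X Z ℂ) :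
    (stack A)ᴴ * stack A = ∑ k, (A k)ᴴ * A k := by
  ext i j
  simp only [stack, Matrix.mul_apply, Matrix.sum_apply, conjTranspose_apply, of_apply,
    Fintype.sum_prod_type_right]

theorem stack_mul_transpose_stack_apply [Fintype Z] (A : K → Matrix X Z ℂ) (B : L → Matrix Y Z ℂ)
    (x : X × K) (y : Y × L) : (stack A * (stack B)ᵀ) x y = (A x.2 * (B y.2)ᵀ) x.1 y.1 :=
  rfl

variable [Fintype X] [Fintype Y] [Fintype Z] [Fintype K] [Fintype L]

theorem frobSq_stack_mul_transpose_stack (A : K → Matrix X Z ℂ) (B : L → Matrix Y Z ℂ) :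
    frobSq (stack A * (stack B)ᵀ) = ∑ k, ∑ l, frobSq (A k * (B l)ᵀ) := by
  simp only [frobSq, stack_mul_transpose_stack_apply, Fintype.sum_prod_type_right]
  exact Finset.sum_congr rfl fun k _ => Finset.sum_comm

theorem overlap_kronecker_stack (A : K → Matrix X Z ℂ) (B : L → Matrix Y Z ℂ) (W : Matrix X Y ℂ)
    (χ : Matrix K L ℂ) :
    overlap (W ⊗ₖ χ) (stack A * (stack B)ᵀ) =
      overlap χ (of fun k l => overlap W (A k * (B l)ᵀ)) := by
  simp only [overlap_eq_sum, stack_mul_transpose_stack_apply, Fintype.sum_prod_type_right,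
    kronecker_apply, of_apply, Finset.mul_sum]
  refine Finset.sum_congr rfl fun k _ => Finset.sum_comm.trans ?_
  refine Finset.sum_congr rfl fun l _ => Finset.sum_congr rfl fun x _ =>
    Finset.sum_congr rfl fun y _ => ?_
  rw [star_mul']
  ring

theorem sqrt_frobSq_le_of_forall_norm_overlap_le {Ω : Matrix X Y ℂ} {C : ℝ} (hC : 0 ≤ C)
    (h : ∀ χ : Matrix X Y ℂ, frobSq χ = 1 → ‖overlap χ Ω‖ ≤ C) : √(frobSq Ω) ≤ C := by
  rcases (frobSq_nonneg Ω).eq_or_lt with h₀ | h₀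
  · rwa [← h₀, Real.sqrt_zero]
  set r : ℂ := (((√(frobSq Ω))⁻¹ : ℝ) : ℂ) with hr
  have hnorm : ‖r‖ = (√(frobSq Ω))⁻¹ := by
    rw [hr, Complex.norm_real, Real.norm_of_nonneg (by positivity)]
  have hself : ‖overlap (r • Ω) Ω‖ = √(frobSq Ω) := by
    rw [overlap, conjTranspose_smul, smul_mul, trace_smul, ← overlap, overlap_self, norm_smul,
      norm_star, hnorm, Complex.norm_real, Real.norm_of_nonneg h₀.le, inv_mul_eq_div,
      Real.div_sqrt]
  rw [← hself]
  refine h _ ?_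
  rw [frobSq_smul, hnorm, inv_pow, Real.sq_sqrt h₀.le, inv_mul_cancel₀ h₀.ne']

variable {ι : Type*} [Fintype ι] [DecidableEq ι] [DecidableEq Z] {W : Matrix X Y ℂ} {w : ι → ℝ}

theorem HasSchmidtWeights.sqrt_sum_norm_overlap_sq_le (hW : HasSchmidtWeights W w)
    (hw : ∑ i, w i = 1) {A : K → Matrix X Z ℂ} {B : L → Matrix Y Z ℂ}
    (hA : ∑ k, (A k)ᴴ * A k ≤ 1) (hB : ∑ l, (B l)ᴴ * B l ≤ 1) {l h R m : ℝ}
    (hl : 0 < l) (hh : 0 < h) (hlh : h < l * R)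
    (hm : ∀ l h : ℝ, 0 < l → h < l * R → ∑ i with l ≤ w i ∧ w i ≤ h, w i ≤ m) :
    √(∑ k, ∑ l, ‖overlap W (A k * (B l)ᵀ)‖ ^ 2) ≤
      1 / √h + √l * Fintype.card Z + √m * √(∑ k, ∑ l, frobSq (A k * (B l)ᵀ)) := by
  classical
  -- Testing against `χ` merges all overlaps into a single overlap of `W ⊗ₖ χ` with a product of two
  -- contractions, and multiplying `w` by the weights of `χ` does not create a heavier window.
  refine sqrt_frobSq_le_of_forall_norm_overlap_le (Ω := of fun k l => overlap W (A k * (B l)ᵀ))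
    (by positivity) fun χ hχ => ?_
  have hv := HasSchmidtWeights.of_isHermitian χ (isHermitian_mul_conjTranspose_self χ)
  generalize (isHermitian_mul_conjTranspose_self χ).eigenvalues = v at hv
  have hv₁ : ∑ k, v k = 1 := hv.sum_eq.trans hχ
  have hwv : ∑ i : ι × K, w i.1 * v i.2 = 1 := by
    rw [Fintype.sum_prod_type, ← Fintype.sum_mul_sum, hw, hv₁, mul_one]
  rw [← overlap_kronecker_stack, ← frobSq_stack_mul_transpose_stack]
  refine ((hW.kronecker hv).norm_overlap_mul_le_of_norm_le_one hwv hl.le hh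
    (norm_le_one_of_conjTranspose_mul_self_le_one ((conjTranspose_stack_mul_stack A).trans_le hA))
    (norm_transpose_le_one_of_conjTranspose_mul_self_le_one
      ((conjTranspose_stack_mul_stack B).trans_le hB))).trans ?_
  gcongr
  exact sum_window_mul_le hv.nonneg hv₁ hl hlh hm

end Stack

section Bounds

open Matrix

variable {X Y X' Y' ι : Type} [Fintype X] [Fintype Y] [Fintype X'] [Fintype Y'] [DecidableEq X]
  [DecidableEq Y] [Fintype ι] [DecidableEq ι] {w : ι → ℝ}

theorem IsLocalOperation.fidelity_pureState_le_of_rank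
    {Φ : Matrix (X × Y) (X × Y) ℂ → Matrix (X' × Y') (X' × Y') ℂ} (hΦ : IsLocalOperation Φ)
    {u : X' × Y' → ℂ} (hu : HasSchmidtWeights (amplitudeMatrix u) w) {l : ℝ} (hl : 0 ≤ l)
    (v : X × Y → ℂ) :
    fidelity u (Φ (pureState v)) ≤
      (√(∑ i with l < w i, w i) + √((amplitudeMatrix v).rank * l)) ^ 2 *
        (Φ (pureState v)).trace.re := by
  obtain ⟨K, L, _, _, A, B, -, -, hΦ⟩ := hΦ
  simp only [hΦ, fidelity_sum, trace_sum, Complex.re_sum, fidelity_kronecker_mul_pureState,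
    trace_re_kronecker_mul_pureState, Finset.mul_sum]
  refine Finset.sum_le_sum fun k _ => Finset.sum_le_sum fun j _ => ?_
  set V := A k * amplitudeMatrix v * (B j)ᵀ
  have hrank : V.rank ≤ (amplitudeMatrix v).rank :=
    (rank_mul_le_left _ _).trans (rank_mul_le_right _ _)
  calc ‖overlap (amplitudeMatrix u) V‖ ^ 2
      ≤ ((√(∑ i with l < w i, w i) + √(V.rank * l)) * √(frobSq V)) ^ 2 := by
        gcongr
        exact hu.norm_overlap_le_of_rank hl V
    _ ≤ ((√(∑ i with l < w i, w i) + √((amplitudeMatrix v).rank * l)) * √(frobSq V)) ^ 2 := by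
        gcongr
    _ = _ := by rw [mul_pow, Real.sq_sqrt (frobSq_nonneg V)]

theorem Protocol.fidelity_run_pureState_le_of_rank [DecidableEq X'] [DecidableEq Y'] {a b c : ℕ}
    (P : Protocol X' Y' a b c) {u : X' × Y' → ℂ} (hu : HasSchmidtWeights (amplitudeMatrix u) w)
    {l : ℝ} (hl : 0 ≤ l) (v : Fin a × Fin b → ℂ) :
    fidelity u (P.run (pureState v)) ≤
      (√(∑ i with l < w i, w i) + √((amplitudeMatrix v).rank * l)) ^ 2 *
        P.successProb (pureState v) := by
  obtain ⟨T, _, Φ, -, hΦ, hrun⟩ := P.exists_isLocalOperation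
  rw [Protocol.successProb, hrun, fidelity_sum, trace_sum, Complex.re_sum, Finset.mul_sum]
  exact Finset.sum_le_sum fun t _ => (hΦ t).fidelity_pureState_le_of_rank hu hl v

end Bounds

section MaxEntangled

open Matrix
open scoped ComplexOrder

variable {X Y ι : Type} {d : ℕ} {u : X × Y → ℂ}

theorem mul_amplitudeMatrix_maxEntangled_mul_transpose (A : Matrix X (Fin d) ℂ)
    (B : Matrix Y (Fin d) ℂ) :
    A * amplitudeMatrix (maxEntangled d) * Bᵀ = (((√(d : ℝ))⁻¹ : ℝ) : ℂ) • (A * Bᵀ) := by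
  rw [amplitudeMatrix_maxEntangled, Matrix.mul_smul, Matrix.mul_one, Matrix.smul_mul]

theorem norm_ofReal_inv_sqrt_natCast_sq (d : ℕ) :
    ‖(((√(d : ℝ))⁻¹ : ℝ) : ℂ)‖ ^ 2 = (d : ℝ)⁻¹ := by
  rw [Complex.norm_real, Real.norm_of_nonneg (by positivity), inv_pow,
    Real.sq_sqrt (Nat.cast_nonneg d)]

variable [Fintype X] [Fintype Y]

theorem fidelity_kronecker_mul_maxEntangled (u : X × Y → ℂ) (A : Matrix X (Fin d) ℂ)
    (B : Matrix Y (Fin d) ℂ) :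
    fidelity u ((A ⊗ₖ B) * pureState (maxEntangled d) * (A ⊗ₖ B)ᴴ) =
      (d : ℝ)⁻¹ * ‖overlap (amplitudeMatrix u) (A * Bᵀ)‖ ^ 2 := by
  rw [fidelity_kronecker_mul_pureState, mul_amplitudeMatrix_maxEntangled_mul_transpose,
    overlap_smul_right, norm_mul, mul_pow, norm_ofReal_inv_sqrt_natCast_sq]

theorem trace_re_kronecker_mul_maxEntangled (A : Matrix X (Fin d) ℂ) (B : Matrix Y (Fin d) ℂ) :
    ((A ⊗ₖ B) * pureState (maxEntangled d) * (A ⊗ₖ B)ᴴ).trace.re =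
      (d : ℝ)⁻¹ * frobSq (A * Bᵀ) := by
  rw [trace_re_kronecker_mul_pureState, mul_amplitudeMatrix_maxEntangled_mul_transpose,
    frobSq_smul, norm_ofReal_inv_sqrt_natCast_sq]

variable [Fintype ι] [DecidableEq ι] {w : ι → ℝ} {R m τ : ℝ}

theorem IsLocalOperation.sqrt_fidelity_maxEntangled_le
    {Φ : Matrix (Fin d × Fin d) (Fin d × Fin d) ℂ → Matrix (X × Y) (X × Y) ℂ}
    (hΦ : IsLocalOperation Φ) (hu : HasSchmidtWeights (amplitudeMatrix u) w)
    (hw : ∑ i, w i = 1) (hτ : 0 < τ) (hR : 1 < τ ^ 2 * R)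
    (hm : ∀ l h : ℝ, 0 < l → h < l * R → ∑ i with l ≤ w i ∧ w i ≤ h, w i ≤ m) :
    √(fidelity u (Φ (pureState (maxEntangled d)))) ≤
      2 * √τ + √m * √(Φ (pureState (maxEntangled d))).trace.re := by
  obtain ⟨K, L, _, _, A, B, hA, hB, hΦ⟩ := hΦ
  simp only [hΦ, fidelity_sum, trace_sum, Complex.re_sum, fidelity_kronecker_mul_maxEntangled,
    trace_re_kronecker_mul_maxEntangled, ← Finset.mul_sum]
  rcases d.eq_zero_or_pos with rfl | hd
  · rw [Nat.cast_zero, _root_.inv_zero, zero_mul, Real.sqrt_zero]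
    positivity
  have hd' : (0 : ℝ) < d := Nat.cast_pos.2 hd
  -- The window `[τ / d, 1 / (d * τ)]` is centred at the Schmidt weight `1 / d` of `maxEntangled d`.
  have hwindow : (d * τ)⁻¹ < τ / d * R := by
    calc (d * τ)⁻¹ = 1 / (d * τ) := (one_div _).symm
      _ < τ ^ 2 * R / (d * τ) := by gcongr
      _ = τ / d * R := by field_simp
  have hbound := hu.sqrt_sum_norm_overlap_sq_le hw hA hB (by positivity) (by positivity) hwindow hm
  have hends : 1 / √(d * τ)⁻¹ + √(τ / d) * d = √d * (2 * √τ) := by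
    have hsplit : √(τ / d) * d = √d * √τ := by
      rw [Real.sqrt_div hτ.le, div_mul_eq_mul_div, mul_div_assoc, Real.div_sqrt, mul_comm]
    rw [hsplit, Real.sqrt_inv, one_div, inv_inv, Real.sqrt_mul hd'.le]
    ring
  rw [Fintype.card_fin, hends] at hbound
  set F := ∑ k, ∑ l, ‖overlap (amplitudeMatrix u) (A k * (B l)ᵀ)‖ ^ 2
  set p := ∑ k, ∑ l, frobSq (A k * (B l)ᵀ)
  calc √((d : ℝ)⁻¹ * F) = (√d)⁻¹ * √F := by
        rw [Real.sqrt_mul (by positivity), Real.sqrt_inv]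
    _ ≤ (√d)⁻¹ * (√d * (2 * √τ) + √m * √p) := by gcongr
    _ = 2 * √τ + √m * ((√d)⁻¹ * √p) := by field_simp
    _ = 2 * √τ + √m * √((d : ℝ)⁻¹ * p) := by
        rw [Real.sqrt_mul (by positivity), Real.sqrt_inv]

theorem sqrt_sum_le_of_sqrt_le {T : Type*} [Fintype T] {F p : T → ℝ} (hF : ∀ t, 0 ≤ F t)
    (hp : ∀ t, 0 ≤ p t) {x a : ℝ} (hx : 0 ≤ x) (ha : 0 ≤ a) (h : ∀ t, √(F t) ≤ x + a * √(p t)) :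
    √(∑ t, F t) ≤ √(Fintype.card T) * x + a * √(∑ t, p t) := by
  let f : EuclideanSpace ℝ T := WithLp.toLp 2 fun _ => x
  let g : EuclideanSpace ℝ T := WithLp.toLp 2 fun t => a * √(p t)
  have hf : ‖f‖ = √(Fintype.card T) * x := by
    simp [f, EuclideanSpace.norm_eq, hx]
  have hg : ‖g‖ = a * √(∑ t, p t) := by
    simp [g, EuclideanSpace.norm_eq, mul_pow, ← Finset.mul_sum, Real.sq_sqrt, hp, ha]
  calc √(∑ t, F t) ≤ ‖f + g‖ := by
        rw [EuclideanSpace.norm_eq]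
        gcongr with t
        rw [← Real.sq_sqrt (hF t)]
        exact pow_le_pow_left₀ (Real.sqrt_nonneg _) ((h t).trans (le_abs_self _)) 2
    _ ≤ ‖f‖ + ‖g‖ := norm_add_le f g
    _ = _ := by rw [hf, hg]

theorem Protocol.sqrt_fidelity_run_maxEntangled_le [DecidableEq X] [DecidableEq Y] {c : ℕ}
    (P : Protocol X Y d d c) (hu : HasSchmidtWeights (amplitudeMatrix u) w)
    (hw : ∑ i, w i = 1) (hτ : 0 < τ) (hR : 1 < τ ^ 2 * R)
    (hm : ∀ l h : ℝ, 0 < l → h < l * R → ∑ i with l ≤ w i ∧ w i ≤ h, w i ≤ m) :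
    √(fidelity u (P.run (pureState (maxEntangled d)))) ≤
      √(2 ^ c) * (2 * √τ) + √m * √(P.successProb (pureState (maxEntangled d))) := by
  obtain ⟨T, _, Φ, hT, hΦ, hrun⟩ := P.exists_isLocalOperation
  have hpos := fun t => (hΦ t).posSemidef (posSemidef_pureState (maxEntangled d))
  rw [Protocol.successProb, hrun, fidelity_sum, trace_sum, Complex.re_sum]
  refine (sqrt_sum_le_of_sqrt_le (fun t => fidelity_nonneg u (hpos t))
    (fun t => (Complex.nonneg_iff.1 (hpos t).trace_nonneg).1) (by positivity) (Real.sqrt_nonneg m)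
    fun t => (hΦ t).sqrt_fidelity_maxEntangled_le hu hw hτ hR hm).trans ?_
  gcongr
  exact_mod_cast hT

end MaxEntangled

section Spectrum

theorem exists_hasSchmidtWeights_entanglementEntropy_eq {p q : ℕ}
    (ψ : EuclideanSpace ℂ (Fin p × Fin q)) :
    ∃ w : Fin p → ℝ, HasSchmidtWeights (amplitudeMatrix ψ.ofLp) w ∧
      entanglementEntropy ψ = shannonEntropy w :=
  ⟨_, .of_isHermitian (amplitudeMatrix ψ.ofLp) (isHermitian_traceB (isHermitian_pureState ψ.ofLp)),
    rfl⟩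

variable {ι : Type*} [Fintype ι] [DecidableEq ι] {w : ι → ℝ} {p q : ℕ}
  {ψ : EuclideanSpace ℂ (Fin p × Fin q)}

theorem HasSchmidtWeights.isMaximallyEntangled (h : HasSchmidtWeights (amplitudeMatrix ψ.ofLp) w)
    (hw : ∑ i, w i = 1) {m : ℝ} (hm : ∀ i, 0 < w i → w i = m) : IsMaximallyEntangled ψ := by
  obtain ⟨u, v, hu, hv, huv⟩ := h.exists_orthonormal
  set r := Fintype.card {i // 0 < w i} with hr
  have hrm : (r : ℝ) * m = 1 := by
    calc (r : ℝ) * m = ∑ i with 0 < w i, m := by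
          rw [Finset.sum_const, nsmul_eq_mul, hr, Fintype.card_subtype]
      _ = ∑ i with 0 < w i, w i :=
          Finset.sum_congr rfl fun i hi => (hm i (Finset.mem_filter.1 hi).2).symm
      _ = 1 := by
          rw [Finset.sum_filter_of_ne fun i _ hi => (h.nonneg i).lt_of_ne' hi, hw]
  let e : Fin r ≃ {i // 0 < w i} := (Fintype.equivFin _).symm
  refine ⟨r, u ∘ e, v ∘ e, hu.comp e e.injective, hv.comp e e.injective, fun x y => ?_⟩
  have hsqrt : ∀ i : {i // 0 < w i}, √(w i) = (√(r : ℝ))⁻¹ := fun i => by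
    rw [hm i i.2, eq_inv_of_mul_eq_one_right hrm, Real.sqrt_inv]
  calc ψ (x, y) = ∑ i : {i // 0 < w i}, (√(w i) : ℂ) * (u i x * v i y) := huv x y
    _ = ((√(r : ℝ))⁻¹ : ℝ) * ∑ i : {i // 0 < w i}, u i x * v i y := by
        simp only [hsqrt, Finset.mul_sum]
    _ = ((√(r : ℝ))⁻¹ : ℝ) * ∑ k, (u ∘ e) k x * (v ∘ e) k y := by
        rw [← e.sum_comp]
        rfl

theorem HasSchmidtWeights.exists_logb_ne (h : HasSchmidtWeights (amplitudeMatrix ψ.ofLp) w)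
    (hw : ∑ i, w i = 1) (hψ : ¬ IsMaximallyEntangled ψ) (c : ℝ) :
    ∃ i, 0 < w i ∧ Real.logb 2 (w i) ≠ c := by
  by_contra! hc
  refine hψ (h.isMaximallyEntangled hw (m := 2 ^ c) fun i hi => ?_)
  rw [← hc i hi, Real.rpow_logb two_pos one_lt_two.ne' hi]

theorem HasSchmidtWeights.sum_eq_sum_norm_sq {X Y : Type*} [Fintype X] [Fintype Y] {u : X × Y → ℂ}
    (h : HasSchmidtWeights (amplitudeMatrix u) w) : ∑ i, w i = ∑ x, ‖u x‖ ^ 2 := by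
  rw [h.sum_eq, frobSq_amplitudeMatrix]

theorem HasSchmidtWeights.tensorPow (h : HasSchmidtWeights (amplitudeMatrix ψ.ofLp) w) (n : ℕ) :
    HasSchmidtWeights (amplitudeMatrix (tensorPow ψ n)) (fun I : Fin n → ι => ∏ k, w (I k)) :=
  amplitudeMatrix_tensorPow ψ n ▸ h.kroneckerPow n

end Spectrum

section Dilution

variable {X Y ι : Type} [Fintype X] [Fintype Y] [DecidableEq X] [DecidableEq Y] [Fintype ι]
  [DecidableEq ι] {w : ι → ℝ} {u : X × Y → ℂ} {d c : ℕ}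

theorem sqrt_three_fourths_le : √(3 / 4 : ℝ) ≤ 87 / 100 :=
  Real.sqrt_le_iff.2 ⟨by norm_num, by norm_num⟩

theorem Protocol.one_div_lt_mul_of_fidelity (P : Protocol X Y d d c)
    (hu : HasSchmidtWeights (amplitudeMatrix u) w) {l : ℝ} (hl : 0 ≤ l)
    (hw : ∑ i with l < w i, w i ≤ 3 / 4)
    (hpos : 0 < P.successProb (pureState (maxEntangled d)))
    (hfid : 99 / 100 * P.successProb (pureState (maxEntangled d)) ≤
      fidelity u (P.run (pureState (maxEntangled d)))) :
    1 / 2 ^ 8 < d * l := by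
  by_contra! hdl
  have hrank : (amplitudeMatrix (maxEntangled d)).rank ≤ d :=
    (Matrix.rank_le_card_width _).trans_eq (Fintype.card_fin d)
  have hlight : √((amplitudeMatrix (maxEntangled d)).rank * l) ≤ 1 / 16 := by
    refine Real.sqrt_le_iff.2 ⟨by norm_num, ?_⟩
    calc ((amplitudeMatrix (maxEntangled d)).rank : ℝ) * l ≤ d * l := by gcongr
      _ ≤ (1 / 16) ^ 2 := by linarith
  have hheavy : √(∑ i with l < w i, w i) ≤ 87 / 100 :=
    (Real.sqrt_le_sqrt hw).trans sqrt_three_fourths_le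
  have hle : fidelity u (P.run (pureState (maxEntangled d))) ≤
      (87 / 100 + 1 / 16) ^ 2 * P.successProb (pureState (maxEntangled d)) :=
    (P.fidelity_run_pureState_le_of_rank hu hl _).trans (by gcongr)
  linarith

theorem Protocol.le_sq_of_fidelity (P : Protocol X Y d d c)
    (hu : HasSchmidtWeights (amplitudeMatrix u) w) (hw : ∑ i, w i = 1) {R : ℝ}
    (hm : ∀ l h : ℝ, 0 < l → h < l * R → ∑ i with l ≤ w i ∧ w i ≤ h, w i ≤ 3 / 4)
    (hpos : 0 < P.successProb (pureState (maxEntangled d)))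
    (hfid : 99 / 100 * P.successProb (pureState (maxEntangled d)) ≤
      fidelity u (P.run (pureState (maxEntangled d)))) :
    R ≤ (2 ^ 10 * 2 ^ c / P.successProb (pureState (maxEntangled d))) ^ 2 := by
  by_contra! hR
  set p := P.successProb (pureState (maxEntangled d))
  have hτR : 1 < (p / (2 ^ 10 * 2 ^ c)) ^ 2 * R := by
    rwa [← div_lt_iff₀' (by positivity), ← one_div_pow, one_div_div]
  have hbound := P.sqrt_fidelity_run_maxEntangled_le hu hw (by positivity) hτR hm
  have hends : √(2 ^ c : ℝ) * (2 * √(p / (2 ^ 10 * 2 ^ c))) = 1 / 16 * √p := by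
    have h1024 : √((2 : ℝ) ^ 10) = 32 := by
      rw [show (2 : ℝ) ^ 10 = 32 ^ 2 by norm_num, Real.sqrt_sq (by norm_num)]
    rw [Real.sqrt_div' _ (by positivity), Real.sqrt_mul (by positivity), h1024]
    field_simp
    norm_num
  have hle : √(99 / 100 * p) ≤ (1 / 16 + 87 / 100) * √p := by
    calc √(99 / 100 * p) ≤ √(fidelity u (P.run (pureState (maxEntangled d)))) :=
          Real.sqrt_le_sqrt hfid
      _ ≤ 1 / 16 * √p + √(3 / 4) * √p := hends ▸ hbound
      _ ≤ (1 / 16 + 87 / 100) * √p := by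
          rw [add_mul]
          gcongr
          exact sqrt_three_fourths_le
  have hsq : 99 / 100 * p ≤ (1 / 16 + 87 / 100) ^ 2 * p := by
    rw [← Real.sq_sqrt hpos.le, ← mul_pow, Real.sq_sqrt hpos.le]
    exact (Real.sqrt_le_left (by positivity)).1 hle
  linarith

theorem Protocol.sub_lt_logb_of_fidelity (P : Protocol X Y d d c)
    (hu : HasSchmidtWeights (amplitudeMatrix u) w) {E : ℝ}
    (hw : ∑ i with (2 : ℝ) ^ (-E) < w i, w i ≤ 3 / 4)
    (hpos : 0 < P.successProb (pureState (maxEntangled d)))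
    (hfid : 99 / 100 * P.successProb (pureState (maxEntangled d)) ≤
      fidelity u (P.run (pureState (maxEntangled d)))) :
    E - 8 < Real.logb 2 d := by
  have hlt := P.one_div_lt_mul_of_fidelity hu (by positivity) hw hpos hfid
  have hd : (0 : ℝ) < d := pos_of_mul_pos_left (lt_trans (by positivity) hlt) (by positivity)
  rw [Real.lt_logb_iff_rpow_lt one_lt_two hd, Real.rpow_sub two_pos]
  rw [Real.rpow_neg two_pos.le, ← div_eq_mul_inv, lt_div_iff₀ (by positivity)] at hlt
  norm_num at hlt ⊢
  linarith

theorem Protocol.le_add_of_fidelity (P : Protocol X Y d d c)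
    (hu : HasSchmidtWeights (amplitudeMatrix u) w) (hw : ∑ i, w i = 1) {r s : ℝ}
    (hm : ∀ l h : ℝ, 0 < l → h < l * 2 ^ (2 * r) → ∑ i with l ≤ w i ∧ w i ≤ h, w i ≤ 3 / 4)
    (hs : (2 : ℝ) ^ (-s) ≤ P.successProb (pureState (maxEntangled d)))
    (hfid : 99 / 100 * P.successProb (pureState (maxEntangled d)) ≤
      fidelity u (P.run (pureState (maxEntangled d)))) :
    r ≤ 10 + c + s := by
  have hpos := lt_of_lt_of_le (by positivity : (0 : ℝ) < 2 ^ (-s)) hs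
  have hle : (2 : ℝ) ^ (2 * r) ≤ 2 ^ (2 * (10 + c + s)) := by
    calc (2 : ℝ) ^ (2 * r)
        ≤ (2 ^ 10 * 2 ^ c / P.successProb (pureState (maxEntangled d))) ^ 2 :=
          P.le_sq_of_fidelity hu hw hm hpos hfid
      _ ≤ (2 ^ 10 * 2 ^ c / 2 ^ (-s)) ^ 2 := by gcongr
      _ = ((2 : ℝ) ^ (10 + c + s)) ^ 2 := by
          rw [Real.rpow_neg two_pos.le, div_inv_eq_mul, Real.rpow_add two_pos,
            Real.rpow_add two_pos, Real.rpow_natCast]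
          norm_num
      _ = 2 ^ (2 * (10 + c + s)) := by
          rw [← Real.rpow_mul_natCast two_pos.le, mul_comm, Nat.cast_two]
  linarith [(Real.rpow_le_rpow_left_iff one_lt_two).1 hle]

end Dilution

end EntanglementDilution

end

theorem theorem1 :
    ∃ ε₀ : ℝ, 1 / 100 ≤ ε₀ ∧
      ∀ (p q : ℕ) (ψ : EuclideanSpace ℂ (Fin p × Fin q)), ‖ψ‖ = 1 →
        ¬ EntanglementDilution.IsSeparable ψ →
        ¬ EntanglementDilution.IsMaximallyEntangled ψ →
        ∃ (α : ℝ) (n₀ : ℕ), 0 < α ∧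
          ∀ ε : ℝ, ε ≤ ε₀ → ∀ n : ℕ, n₀ ≤ n →
            ∀ (d c : ℕ) (s : ℝ)
              (P : EntanglementDilution.Protocol (Fin n → Fin p) (Fin n → Fin q) d d c),
              (2 : ℝ) ^ (-s) ≤
                P.successProb
                  (EntanglementDilution.pureState (EntanglementDilution.maxEntangled d)) →
              EntanglementDilution.traceDist
                (P.output
                  (EntanglementDilution.pureState (EntanglementDilution.maxEntangled d)))
                (EntanglementDilution.pureState (EntanglementDilution.tensorPow ψ n)) ≤ ε →
              n * EntanglementDilution.entanglementEntropy ψ + α * √(n : ℝ) ≤ Real.logb 2 d ∧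
                α * √(n : ℝ) ≤ c + s := by
  refine ⟨1 / 100, le_rfl, fun p q ψ hψ _ hψ' => ?_⟩
  obtain ⟨w, hw, hE⟩ := EntanglementDilution.exists_hasSchmidtWeights_entanglementEntropy_eq ψ
  have hw₁ : ∑ i, w i = 1 := by
    rw [hw.sum_eq_sum_norm_sq, ← EuclideanSpace.norm_sq_eq, hψ, one_pow]
  obtain ⟨β, hβ, hanti⟩ :=
    EntanglementDilution.exists_anticoncentration hw.nonneg hw₁ (hw.exists_logb_ne hw₁ hψ' _)
  have hlarge : ∀ᶠ n : ℕ in Filter.atTop, 10 ≤ β / 2 * √(n : ℝ) :=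
    ((Real.tendsto_sqrt_atTop.comp tendsto_natCast_atTop_atTop).const_mul_atTop
      (half_pos hβ)).eventually_ge_atTop 10
  obtain ⟨n₀, hn₀⟩ := Filter.eventually_atTop.1 (hanti.and hlarge)
  refine ⟨β / 2, n₀, half_pos hβ, fun ε hε n hn d c s P hs hP => ?_⟩
  obtain ⟨⟨htail, hwindow⟩, hn⟩ := hn₀ n hn
  have hpos := lt_of_lt_of_le (Real.rpow_pos_of_pos two_pos (-s)) hs
  have hwn := hw.tensorPow n
  have hwn₁ : ∑ I : Fin n → Fin p, ∏ k, w (I k) = 1 := by rw [← Fintype.sum_pow, hw₁, one_pow]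
  have hfid := P.mul_successProb_le_fidelity_run
    (EntanglementDilution.posSemidef_pureState _)
    (hwn.sum_eq_sum_norm_sq.symm.trans hwn₁) hpos (hP.trans hε)
  rw [show (1 : ℝ) - 1 / 100 = 99 / 100 by norm_num] at hfid
  have ha := P.sub_lt_logb_of_fidelity hwn htail hpos hfid
  have hb := P.le_add_of_fidelity hwn hwn₁ hwindow hs hfid
  rw [hE]
  constructor <;> linarith
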